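/- Let $n\ge 1$ be an integer, $\gamma>1$ and $s\ge 0$. Consider the Cauchy problem $$u_{tt}-\Delta u-\Delta u_t+g*\Delta u=0\quad (x\in\mathbb R^n,\ t>0),\qquad (u,u_t)(0,x)=(u_0,u_1)(x),$$ where $g(t)=e^{-\gamma t}$ and $(g*\Delta u)(t,x)=\int_0^t g(t-\eta)\,\Delta u(\eta,x)\,d\eta$. A solution is a function $u\in C([0,\infty);L^2(\mathbb R^n))$ which, as a function of $t$ with values in the tempered distributions, is $C^1$ on $[0,\infty)$ and twice differentiable on $(0,\infty)$, satisfies the equation in the sense of tempered distributions for every $t>0$, and has the given initial data. Let $L^{1,1}(\mathbb R^n)$ be the space of $f\in L^1(\mathbb R^n)$ with $\|f\|_{L^{1,1}}:=\int_{\mathbb R^n}(1+|x|)|f(x)|\,dx<\infty$, let $P_f:=\int_{\mathbb R^n}f(x)\,dx$, let $\|f\|_{H^\sigma\cap L^{1,1}}:=\|f\|_{H^\sigma}+\|f\|_{L^{1,1}}$, let $|D|^s$ be the operator with Fourier symbol $|\xi|^s$, and put $$\mathcal G(t;s,n):=\begin{cases}(1+t)^{1-s-\frac n2}&\text{if } 2s+n<2,\\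 (\ln(e+t))^{\frac12}&\text{if } 2s+n=2,\\ (1+t)^{1-\frac{5s}{6}-\frac{5n}{12}}&\text{if } 2<2s+n<3,\\ (1+t)^{\frac12-\frac s2-\frac n4}&\text{if } 2s+n\ge 3.\end{cases}$$ Then there is a constant $C>0$ depending only on $n$, $\gamma$ and $s$ such that for all $$(u_0,u_1)\in\bigl(H^s(\mathbb R^n)\cap L^{1,1}(\mathbb R^n)\bigr)\times\bigl(H^{\max\{s-2,0\}}(\mathbb R^n)\cap L^{1,1}(\mathbb R^n)\bigr)$$ the Cauchy problem has a unique solution $u$, and for all $t\ge 0$ one has $|D|^su(t,\cdot)\in L^2(\mathbb R^n)$ and $$\begin{aligned}\||D|^su(t,\cdot)\|_{L^2}\le C\Bigl(&(1+t)^{-\frac{s+1}2-\frac n4}\|u_0\|_{H^s\cap L^{1,1}}+(1+t)^{-\frac s2-\frac n4}|P_{u_0}|\\&+(1+t)^{-\frac s2-\frac n4}\|u_1\|_{H^{\max\{s-2,0\}}\cap L^{1,1}}+\mathcal G(t;s,n)\,|P_{u_1}|\Bigr).\end{aligned}$$ -/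

import Mathlib

open MeasureTheory Set FourierTransform
open scoped SchwartzMap Laplacian

noncomputable section

/-- Euclidean space `ℝⁿ`. -/
abbrev Rn (n : ℕ) := EuclideanSpace ℝ (Fin n)

/-- The Hilbert space `L²(ℝⁿ)` of complex-valued functions. -/
abbrev L2 (n : ℕ) := Lp ℂ 2 (volume : Measure (Rn n))

/-- `L²` functions regarded as tempered distributions, `⟨f, φ⟩ = ∫ φ f dx`. -/
abbrev toDist {n : ℕ} (f : L2 n) : 𝓢'(Rn n, ℂ) := Lp.toTemperedDistribution f

/-- The exponentially decaying relaxation function `g(t) = e^{-γ t}`. -/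
def relaxation (γ t : ℝ) : ℝ := Real.exp (-γ * t)

/-- `u` is a solution on `[0, ∞) × ℝⁿ` of
`u_tt - Δ u - Δ u_t + g ∗ Δ u = 0`, `(u, u_t)(0) = (u₀, u₁)`,
where `(g ∗ Δ u)(t) = ∫₀ᵗ g(t - η) Δ u(η) dη` and `g(t) = e^{-γ t}`:
`u` lies in `C([0, ∞); L²(ℝⁿ))`, it has a first time derivative `v = u_t` on `[0, ∞)`
(one-sided at `0`), continuous there, and a second time derivative `w = u_tt` on `(0, ∞)`,
both in the sense of tempered distributions in `x` (that is, after pairing with each Schwartz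
function), and the equation holds in the sense of tempered distributions for all `t > 0`. -/
def IsSolution {n : ℕ} (γ : ℝ) (u₀ u₁ : L2 n) (u : ℝ → L2 n) : Prop :=
  ContinuousOn u (Ici 0) ∧ u 0 = u₀ ∧
  ∃ v w : ℝ → 𝓢'(Rn n, ℂ), v 0 = toDist u₁ ∧
    ∀ φ : 𝓢(Rn n, ℂ),
      (∀ t, 0 ≤ t → HasDerivWithinAt (fun τ => toDist (u τ) φ) (v t φ) (Ici 0) t) ∧
      ContinuousOn (fun t => v t φ) (Ici 0) ∧
      (∀ t, 0 < t → HasDerivAt (fun τ => v τ φ) (w t φ) t) ∧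
      ∀ t, 0 < t →
        w t φ - (Δ (toDist (u t))) φ - (Δ (v t)) φ
          + ∫ η in (0 : ℝ)..t, (relaxation γ (t - η) : ℂ) * (Δ (toDist (u η))) φ = 0

/-- `w = |D|^s f` in `L²(ℝⁿ)`, where `|D|^s` is the operator with symbol `|ξ|^s`. In Mathlib's
normalisation `𝓕 f ξ = ∫ e^{-2πi x·ξ} f(x) dx` of the (unitary) Fourier transform the frequency
variable is `2π ξ`. -/
def IsFracDeriv {n : ℕ} (s : ℝ) (f w : L2 n) : Prop :=
  ∀ᵐ ξ : Rn n, (𝓕 w : L2 n) ξ = (((2 * Real.pi * ‖ξ‖) ^ s : ℝ) : ℂ) * (𝓕 f : L2 n) ξ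

/-- Membership in the Sobolev space `H^s(ℝⁿ)`. -/
def MemH {n : ℕ} (s : ℝ) (f : L2 n) : Prop :=
  TemperedDistribution.MemSobolev s 2 (toDist f)

/-- The norm of `H^s(ℝⁿ)`, i.e. the `L²` norm of `(1 + |ξ|²)^{s/2} f̂(ξ)`; as above, the frequency
variable is `2π ξ`. -/
def normH {n : ℕ} (s : ℝ) (f : L2 n) : ℝ :=
  (eLpNorm (fun ξ : Rn n =>
    (((1 + (2 * Real.pi * ‖ξ‖) ^ 2) ^ (s / 2) : ℝ) : ℂ) * (𝓕 f : L2 n) ξ) 2 volume).toReal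

/-- Membership in the weighted space `L^{1,1}(ℝⁿ)`. -/
def MemL11 {n : ℕ} (f : L2 n) : Prop :=
  Integrable f ∧ Integrable (fun x : Rn n => (1 + ‖x‖) * ‖f x‖)

/-- The norm of `L^{1,1}(ℝⁿ)`. -/
def normL11 {n : ℕ} (f : L2 n) : ℝ := ∫ x : Rn n, (1 + ‖x‖) * ‖f x‖

/-- The integral `P_f = ∫ f dx`. -/
def totalIntegral {n : ℕ} (f : L2 n) : ℂ := ∫ x : Rn n, f x

/-- The time-dependent coefficient `𝒢(t; s, n)`. -/
def growthG (t s : ℝ) (n : ℕ) : ℝ :=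
  if 2 * s + n < 2 then (1 + t) ^ (1 - s - (n : ℝ) / 2)
  else if 2 * s + n = 2 then (Real.log (Real.exp 1 + t)) ^ (1 / 2 : ℝ)
  else if 2 * s + n < 3 then (1 + t) ^ (1 - 5 * s / 6 - 5 * (n : ℝ) / 12)
  else (1 + t) ^ (1 / 2 - s / 2 - (n : ℝ) / 4)

end

/-! The Fourier transform in `x` turns the equation into one scalar integro-differential equation
for each value `a = |ξ|²`. Because the kernel is exponential, the memory `z = g ∗ u` solves `z' = u
- γ z`, so each mode obeys a linear 3×3 system without delay. The memory lowers the effective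
stiffness from `1` to `1 - ∫ g = 1 - 1/γ`, which stays positive exactly because `γ > 1`.

Two Lyapunov functionals give the decay of the modes. For `a ≤ 2` (`energy_low`) the rate is
proportional to `a`, as for the heat equation; for `a ≥ 2` (`energy_high`) it is uniform in `a`. The
mode with data `(0, 1)` is at most a constant times `e^{-cat}/√a` and times `t` at low frequencies,
and gains a factor `1/a` at high ones; this gain is why `u₁` needs two derivatives fewer than `u₀`.

For data in `L^{1,1}` one has `|f̂(ξ)| ≤ |P_f| + |ξ| ‖f‖_{L^{1,1}}`. The factor `|ξ|` yields an
extra `(1+t)^{-1/2}` for `u₀` and cancels the singularity `1/√a` for `u₁`, so only `P_{u₁}` meets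
that singularity. Its contribution is the `L²` norm of `|ξ|^s` times the mode near `ξ = 0`, and the
integral of `y^{2s+n-1} min(1+t, 1/y)²` explains the threshold `2s+n = 2`. Above it the heat rate
`(1+t)^{1/2-s/2-n/4}` holds throughout, and it is at least as good as `growthG` on `2 < 2s+n < 3`.

Existence superposes the modes (`isSolution_ofSpectrum`). For uniqueness (`IsSolution.unique`), test
functions with frequencies in a fixed ball make `Δ` a bounded operator, and a Picard iteration
annihilates the difference of two solutions. -/

/-! ### The mode equation -/

/-- The first order system satisfied by a Fourier mode: `u' = v`, `v' = -a u - a v + a z`,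
where `z = g ∗ u` solves `z' = u - γ z`. -/
structure IsMode (γ a : ℝ) (u v z : ℝ → ℝ) : Prop where
  hasDerivAt_u : ∀ t, HasDerivAt u (v t) t
  hasDerivAt_v : ∀ t, HasDerivAt v (-a * u t - a * v t + a * z t) t
  hasDerivAt_z : ∀ t, HasDerivAt z (u t - γ * z t) t

/-- Grönwall: `E t * exp (-k t)` is nonincreasing. The rate `k` may have either sign; it is negative
for the decay estimates and positive for the crude one. -/
theorem le_mul_exp_of_hasDerivAt_le {E E' : ℝ → ℝ} {k : ℝ} (hE : ∀ t, HasDerivAt E (E' t) t)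
    (h : ∀ t, E' t ≤ k * E t) {t : ℝ} (ht : 0 ≤ t) : E t ≤ E 0 * Real.exp (k * t) := by
  have hd : ∀ t, HasDerivAt (fun t => E t * Real.exp (-k * t))
      (E' t * Real.exp (-k * t) + E t * (Real.exp (-k * t) * (-k * 1))) t := fun t =>
    (hE t).mul (((hasDerivAt_id t).const_mul (-k)).exp)
  have hanti : Antitone (fun t => E t * Real.exp (-k * t)) := by
    refine antitone_of_hasDerivAt_nonpos hd fun t => ?_
    have := mul_le_mul_of_nonneg_right (h t) (Real.exp_pos (-k * t)).le
    simp only [Pi.zero_apply]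
    linarith
  have h0 := hanti ht
  simp only [mul_zero, Real.exp_zero, mul_one] at h0
  calc E t = E t * Real.exp (-k * t) * Real.exp (k * t) := by
        rw [mul_assoc, ← Real.exp_add]; simp
    _ ≤ _ := mul_le_mul_of_nonneg_right h0 (Real.exp_pos _).le

namespace IsMode

variable {γ a : ℝ} {u v z : ℝ → ℝ}

/-- With `r = u - γ z = z'`, the natural energy `γ v² + a(γ-1) u² + a r²` has derivative `-2γ a (v²
+ r²)`, with no damping of `u`. The cross term `2δ a u v` supplies the missing `-a² u²`, at the
price of terms that the damping of `v` and `r` absorbs when `δ` is small. -/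
theorem energy_low (h : IsMode γ a u v z) (hγ : 1 < γ) (ha : 0 ≤ a) (ha2 : a ≤ 2)
    (hz : z 0 = 0) {t : ℝ} (ht : 0 ≤ t) :
    v t ^ 2 + a * u t ^ 2 ≤ 4 * γ / (γ - 1) * Real.exp (-2 * ((γ - 1) / (48 * γ)) * a * t)
      * (v 0 ^ 2 + a * u 0 ^ 2) := by
  set δ : ℝ := (γ - 1) / 12 with hδ
  set k : ℝ := (γ - 1) / (48 * γ) with hk
  have hγ0 : 0 < γ := by linarith
  have hkδ : k * γ = δ / 4 := by rw [hk, hδ]; field_simp; ring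
  have hδ0 : 0 < δ := by rw [hδ]; linarith
  have hk0 : 0 < k := by rw [hk]; have : 0 < γ - 1 := by linarith
                         positivity
  have hg : γ = 1 + 12 * δ := by rw [hδ]; ring
  let E : ℝ → ℝ := fun t => γ * v t ^ 2 + a * (γ - 1) * u t ^ 2 + a * (u t - γ * z t) ^ 2
    + 2 * δ * a * (u t * v t)
  let E' : ℝ → ℝ := fun t =>
    γ * (2 * v t * (-a * u t - a * v t + a * z t)) + a * (γ - 1) * (2 * u t * v t)
    + a * (2 * (u t - γ * z t) * (v t - γ * (u t - γ * z t)))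
    + 2 * δ * a * (v t * v t + u t * (-a * u t - a * v t + a * z t))
  have hE : ∀ t, HasDerivAt E (E' t) t := fun t => by
    have h1 := ((h.hasDerivAt_v t).pow 2).const_mul γ
    have h2 := ((h.hasDerivAt_u t).pow 2).const_mul (a * (γ - 1))
    have h3 := (((h.hasDerivAt_u t).sub ((h.hasDerivAt_z t).const_mul γ)).pow 2).const_mul a
    have h4 := ((h.hasDerivAt_u t).mul (h.hasDerivAt_v t)).const_mul (2 * δ * a)
    refine (((h1.add h2).add h3).add h4).congr_deriv ?_
    simp only [E', Pi.sub_apply]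
    push_cast
    ring
  have hle : ∀ t, E' t ≤ -2 * k * a * E t := fun t => by
    set r := u t - γ * z t with hr
    have hz : z t = (u t - r) / γ := by rw [hr]; field_simp; ring
    have hk' : k = δ / (4 * γ) := by rw [← mul_right_inj' hγ0.ne', mul_comm, hkδ]; field_simp
    set c := γ - δ / 2 with hc
    -- The two cross terms `u v` and `u r` are absorbed by completing squares, each using half of `9
    -- δ² u²`. What remains are the coefficients of `v²` and `r²` in `h3` and `h4`, nonnegative
    -- because `a ≤ 2`.
    have hc2 : c ^ 2 ≤ γ ^ 2 := by nlinarith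
    have key : 0 ≤ a * (9 * δ ^ 2 * u t ^ 2 + δ * c * (u t * v t) + δ * (u t * r))
        + (γ ^ 2 - 5 / 4 * (δ * γ)) * v t ^ 2 + (γ ^ 2 - δ * a / 4) * r ^ 2 := by
      have h1 := mul_nonneg ha (sq_nonneg (δ * u t + c * v t / 9))
      have h2 := mul_nonneg ha (sq_nonneg (δ * u t + r / 9))
      have h3 : 0 ≤ (γ ^ 2 - 5 / 4 * (δ * γ) - a * c ^ 2 / 18) * v t ^ 2 := by
        refine mul_nonneg ?_ (sq_nonneg _)
        have : a * c ^ 2 ≤ 2 * γ ^ 2 := mul_le_mul ha2 hc2 (sq_nonneg _) (by norm_num)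
        nlinarith
      have h4 : 0 ≤ (γ ^ 2 - δ * a / 4 - a / 18) * r ^ 2 := by
        refine mul_nonneg ?_ (sq_nonneg _)
        have : δ * a ≤ δ * 2 := mul_le_mul_of_nonneg_left ha2 hδ0.le
        nlinarith
      nlinarith
    have hid : E' t + 2 * k * a * E t = -(2 * a / γ) *
        (a * (9 * δ ^ 2 * u t ^ 2 + δ * c * (u t * v t) + δ * (u t * r))
        + (γ ^ 2 - 5 / 4 * (δ * γ)) * v t ^ 2 + (γ ^ 2 - δ * a / 4) * r ^ 2) := by
      simp only [E, E']
      rw [← hr, hz, hk', hc]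
      have hδ' : δ = (γ - 1) / 12 := hδ
      clear_value δ
      subst hδ'
      field_simp
      ring
    have : 0 ≤ 2 * a / γ * (a * (9 * δ ^ 2 * u t ^ 2 + δ * c * (u t * v t) + δ * (u t * r))
        + (γ ^ 2 - 5 / 4 * (δ * γ)) * v t ^ 2 + (γ ^ 2 - δ * a / 4) * r ^ 2) :=
      mul_nonneg (by positivity) key
    linarith
  have hfin := le_mul_exp_of_hasDerivAt_le hE hle ht
  have hlow : (γ - 1) / 2 * (v t ^ 2 + a * u t ^ 2) ≤ E t := by
    simp only [E]
    have h1 := mul_nonneg (mul_nonneg ha hδ0.le) (sq_nonneg (u t + v t))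
    have h2 := mul_nonneg ha (sq_nonneg (u t - γ * z t))
    have h3 := mul_nonneg (mul_nonneg (sub_nonneg.2 ha2) hδ0.le) (sq_nonneg (v t))
    have h4 := mul_nonneg (mul_nonneg ha hδ0.le) (sq_nonneg (u t))
    have h5 := mul_nonneg hδ0.le (sq_nonneg (v t))
    have h6 := sq_nonneg (v t)
    rw [hg]
    nlinarith
  have hup : E 0 ≤ 2 * γ * (v 0 ^ 2 + a * u 0 ^ 2) := by
    simp only [E, hz]
    have h1 := mul_nonneg (mul_nonneg ha hδ0.le) (sq_nonneg (u 0 - v 0))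
    have h3 := mul_nonneg (mul_nonneg (sub_nonneg.2 ha2) hδ0.le) (sq_nonneg (v 0))
    have h4 := mul_nonneg (mul_nonneg ha hδ0.le) (sq_nonneg (u 0))
    have h5 := mul_nonneg hδ0.le (sq_nonneg (v 0))
    have h6 := sq_nonneg (v 0)
    have h7 := mul_nonneg ha (sq_nonneg (u 0))
    rw [hg]
    nlinarith
  have hexp := Real.exp_pos (-2 * k * a * t)
  have hγ1 : 0 < γ - 1 := by linarith
  have := mul_le_mul_of_nonneg_right hup hexp.le
  calc v t ^ 2 + a * u t ^ 2 = 2 / (γ - 1) * ((γ - 1) / 2 * (v t ^ 2 + a * u t ^ 2)) := by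
        field_simp
    _ ≤ 2 / (γ - 1) * (2 * γ * (v 0 ^ 2 + a * u 0 ^ 2) * Real.exp (-2 * k * a * t)) :=
        mul_le_mul_of_nonneg_left (hlow.trans (hfin.trans this)) (by positivity)
    _ = _ := by ring

/-- In the variables `p = u + v/a`, `z`, `w = v/a` the couplings of `w` with `p` and `z` are skew
and drop out of the derivative of `p² + z² + w²`. There remain `-2(a-1) w²` and minus twice the
quadratic form `p² - 2pz + γ z²`, of determinant `γ - 1` and trace `γ + 1`; the ratio of these is a
lower bound for its smallest eigenvalue and serves as the rate. -/
theorem energy_high (h : IsMode γ a u v z) (hγ : 1 < γ) (ha : 2 ≤ a)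
    (hz : z 0 = 0) {t : ℝ} (ht : 0 ≤ t) :
    u t ^ 2 + (v t / a) ^ 2 + z t ^ 2 ≤ 9 * Real.exp (-2 * ((γ - 1) / (γ + 1)) * t)
      * (u 0 ^ 2 + (v 0 / a) ^ 2) := by
  set k : ℝ := (γ - 1) / (γ + 1) with hk
  have hk1 : k * (γ + 1) = γ - 1 := div_mul_cancel₀ _ (by linarith)
  have hk0 : 0 < k := div_pos (by linarith) (by linarith)
  have hk2 : k < 1 := by rw [hk, div_lt_one (by linarith)]; linarith
  have ha0 : a ≠ 0 := by linarith
  let E : ℝ → ℝ := fun t => (u t + v t / a) ^ 2 + z t ^ 2 + (v t / a) ^ 2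
  let E' : ℝ → ℝ := fun t =>
    2 * (u t + v t / a) * (z t - u t) + 2 * z t * (u t - γ * z t)
      + 2 * (v t / a) * (-u t - v t + z t)
  have hE : ∀ t, HasDerivAt E (E' t) t := fun t => by
    have hw := (h.hasDerivAt_v t).div_const a
    have h1 := ((h.hasDerivAt_u t).add hw).pow 2
    refine ((h1.add ((h.hasDerivAt_z t).pow 2)).add (hw.pow 2)).congr_deriv ?_
    simp only [E', Pi.add_apply]
    push_cast
    field_simp
    ring
  have hle : ∀ t, E' t ≤ -2 * k * E t := fun t => by
    have hv : v t = a * (v t / a) := by field_simp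
    simp only [E, E']
    set w := v t / a
    rw [hv]
    set p := u t + w with hp
    have hu : u t = p - w := by rw [hp]; ring
    rw [hu]
    have hform : 0 ≤ (1 - k) * p ^ 2 - 2 * p * z t + (γ - k) * z t ^ 2 := by
      refine nonneg_of_mul_nonneg_right (?_ : 0 ≤ (1 - k) * _) (by linarith : 0 < 1 - k)
      have : (1 - k) * ((1 - k) * p ^ 2 - 2 * p * z t + (γ - k) * z t ^ 2)
          = ((1 - k) * p - z t) ^ 2 + k ^ 2 * z t ^ 2
            + (γ - 1 - k * (γ + 1)) * z t ^ 2 := by ring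
      rw [this, hk1]
      nlinarith [sq_nonneg ((1 - k) * p - z t), sq_nonneg (k * z t)]
    nlinarith [mul_nonneg (by linarith : 0 ≤ a - 1 - k) (sq_nonneg w)]
  have := le_mul_exp_of_hasDerivAt_le hE hle ht
  have hlow : u t ^ 2 + (v t / a) ^ 2 + z t ^ 2 ≤ 3 * E t := by
    simp only [E]
    nlinarith [sq_nonneg (u t + 2 * (v t / a)), sq_nonneg (u t + v t / a), sq_nonneg (z t),
      sq_nonneg (v t / a), sq_nonneg (2 * u t + 3 * (v t / a))]
  have hup : E 0 ≤ 3 * (u 0 ^ 2 + (v 0 / a) ^ 2) := by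
    simp only [E, hz]
    nlinarith [sq_nonneg (u 0 - (v 0 / a)), sq_nonneg (u 0), sq_nonneg (v 0 / a)]
  have hexp := Real.exp_pos (-2 * k * t)
  nlinarith

/-- `energy_low` controls only `√a u` and does not bound `z`. This bound is uniform down to `a = 0`;
growth in time is harmless, since it serves only domination on bounded time intervals. -/
theorem energy_crude (h : IsMode γ a u v z) (hγ : 1 < γ) (ha : 0 ≤ a) (ha2 : a ≤ 2)
    {t : ℝ} (ht : 0 ≤ t) :
    u t ^ 2 + v t ^ 2 + z t ^ 2 ≤ (u 0 ^ 2 + v 0 ^ 2 + z 0 ^ 2) * Real.exp (6 * t) := by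
  refine le_mul_exp_of_hasDerivAt_le (E := fun t => u t ^ 2 + v t ^ 2 + z t ^ 2)
    (E' := fun t => 2 * u t * v t + 2 * v t * (-a * u t - a * v t + a * z t)
      + 2 * z t * (u t - γ * z t)) (fun t => ?_) (fun t => ?_) ht
  · refine ((((h.hasDerivAt_u t).pow 2).add ((h.hasDerivAt_v t).pow 2)).add
      ((h.hasDerivAt_z t).pow 2)).congr_deriv ?_
    push_cast
    ring
  · have h1 := mul_nonneg ha (sq_nonneg (v t))
    have h2 := mul_nonneg ha (sq_nonneg (v t - z t))
    have h3 := mul_nonneg ha (sq_nonneg (u t + v t))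
    have h4 := mul_nonneg (sub_nonneg.2 ha2) (sq_nonneg (u t))
    have h5 := mul_nonneg (sub_nonneg.2 ha2) (sq_nonneg (v t))
    have h6 := mul_nonneg (sub_nonneg.2 ha2) (sq_nonneg (z t))
    have h7 := mul_nonneg (by linarith : 0 ≤ γ) (sq_nonneg (z t))
    nlinarith [sq_nonneg (u t - v t), sq_nonneg (u t - z t)]

end IsMode

/-! ### The flow of the mode system and its decay -/

/-- The generator of the system `IsMode`, acting on `(u, v, z)`. -/
noncomputable def modeGenerator (γ a : ℝ) : (ℝ × ℝ × ℝ) →L[ℝ] (ℝ × ℝ × ℝ) :=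
  let U := ContinuousLinearMap.fst ℝ ℝ (ℝ × ℝ)
  let V := (ContinuousLinearMap.fst ℝ ℝ ℝ).comp (ContinuousLinearMap.snd ℝ ℝ (ℝ × ℝ))
  let Z := (ContinuousLinearMap.snd ℝ ℝ ℝ).comp (ContinuousLinearMap.snd ℝ ℝ (ℝ × ℝ))
  V.prod ((0 : (ℝ × ℝ × ℝ) →L[ℝ] ℝ).prod (U - γ • Z))
    + a • (0 : (ℝ × ℝ × ℝ) →L[ℝ] ℝ).prod ((-U - V + Z).prod 0)

theorem modeGenerator_apply (γ a : ℝ) (x : ℝ × ℝ × ℝ) :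
    modeGenerator γ a x =
      (x.2.1, -a * x.1 - a * x.2.1 + a * x.2.2, x.1 - γ * x.2.2) := by
  ext <;> simp [modeGenerator]
  ring

/-- The flow of the system `IsMode` at time `t`, started at `x`. -/
noncomputable def modeFlow (γ : ℝ) (x : ℝ × ℝ × ℝ) (t a : ℝ) : ℝ × ℝ × ℝ :=
  NormedSpace.exp (t • modeGenerator γ a) x

theorem modeFlow_zero (γ : ℝ) (x : ℝ × ℝ × ℝ) (a : ℝ) : modeFlow γ x 0 a = x := by
  simp [modeFlow]

/-- The generator is affine in `a` and the exponential is continuous. Joint continuity gives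
continuity in time and measurability in `ξ` at once. -/
theorem continuous_modeFlow (γ : ℝ) (x : ℝ × ℝ × ℝ) :
    Continuous fun p : ℝ × ℝ => modeFlow γ x p.1 p.2 := by
  have h : Continuous fun p : ℝ × ℝ => p.1 • modeGenerator γ p.2 := by
    unfold modeGenerator
    fun_prop
  let : NormedAlgebra ℚ ((ℝ × ℝ × ℝ) →L[ℝ] (ℝ × ℝ × ℝ)) := NormedAlgebra.restrictScalars ℚ ℝ _
  exact (NormedSpace.exp_continuous.comp h).clm_apply continuous_const

theorem isMode_modeFlow (γ a : ℝ) (x : ℝ × ℝ × ℝ) :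
    IsMode γ a (fun t => (modeFlow γ x t a).1) (fun t => (modeFlow γ x t a).2.1)
      (fun t => (modeFlow γ x t a).2.2) := by
  have h : ∀ t, HasDerivAt (fun t => modeFlow γ x t a)
      (modeGenerator γ a (modeFlow γ x t a)) t := fun t =>
    (ContinuousLinearMap.apply ℝ (ℝ × ℝ × ℝ) x).hasFDerivAt.comp_hasDerivAt t
      (hasDerivAt_exp_smul_const' (modeGenerator γ a) t)
  simp only [modeGenerator_apply] at h
  exact ⟨fun t => (h t).fst, fun t => (h t).snd.fst, fun t => (h t).snd.snd⟩

namespace IsMode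

variable {γ a : ℝ} {u v z : ℝ → ℝ}

/-- Bounds uniform in frequency on `[0, T]`. Only `v` needs the weight `1 + a`, since for large `a`
the energy controls `v / a`. -/
theorem abs_le_of_le (h : IsMode γ a u v z) (hγ : 1 < γ) (ha : 0 ≤ a) (hz : z 0 = 0)
    (h0 : u 0 ^ 2 + v 0 ^ 2 ≤ 1) {t T : ℝ} (ht : 0 ≤ t) (htT : t ≤ T) :
    |u t| ≤ 3 * Real.exp (3 * T) ∧ |v t| ≤ 3 * Real.exp (3 * T) * (1 + a) ∧
      |z t| ≤ 3 * Real.exp (3 * T) := by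
  have hE : 1 ≤ Real.exp (3 * T) := Real.one_le_exp (by linarith)
  rcases le_total a 2 with ha2 | ha2
  · have := h.energy_crude hγ ha ha2 ht
    have h6 : Real.exp (6 * t) ≤ Real.exp (3 * T) ^ 2 := by
      rw [← Real.exp_nat_mul]; apply Real.exp_le_exp.2; push_cast; linarith
    have h7 : u t ^ 2 + v t ^ 2 + z t ^ 2 ≤ Real.exp (3 * T) ^ 2 := by
      refine this.trans ?_
      rw [hz]
      nlinarith [Real.exp_pos (6 * t)]
    have hu : |u t| ≤ Real.exp (3 * T) :=
      abs_le_of_sq_le_sq (by nlinarith [sq_nonneg (v t), sq_nonneg (z t)]) (by linarith)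
    have hv : |v t| ≤ Real.exp (3 * T) :=
      abs_le_of_sq_le_sq (by nlinarith [sq_nonneg (u t), sq_nonneg (z t)]) (by linarith)
    have hz : |z t| ≤ Real.exp (3 * T) :=
      abs_le_of_sq_le_sq (by nlinarith [sq_nonneg (u t), sq_nonneg (v t)]) (by linarith)
    exact ⟨by linarith, by nlinarith, by linarith⟩
  · have := h.energy_high hγ ha2 hz ht
    have h1 : Real.exp (-2 * ((γ - 1) / (γ + 1)) * t) ≤ 1 := by
      apply Real.exp_le_one_iff.2
      have : 0 ≤ (γ - 1) / (γ + 1) * t :=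
        mul_nonneg (div_nonneg (by linarith) (by linarith)) ht
      linarith
    have h2 : (v 0 / a) ^ 2 ≤ v 0 ^ 2 := by
      rw [div_pow]
      exact div_le_self (sq_nonneg _) (by nlinarith)
    have h3 : u t ^ 2 + (v t / a) ^ 2 + z t ^ 2 ≤ 3 ^ 2 := by
      refine this.trans ?_
      have h5 : 0 ≤ u 0 ^ 2 + (v 0 / a) ^ 2 := by positivity
      nlinarith [Real.exp_pos (-2 * ((γ - 1) / (γ + 1)) * t)]
    have hu : |u t| ≤ 3 :=
      abs_le_of_sq_le_sq (by nlinarith [sq_nonneg (v t / a), sq_nonneg (z t)]) (by linarith)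
    have hv : |v t / a| ≤ 3 :=
      abs_le_of_sq_le_sq (by nlinarith [sq_nonneg (u t), sq_nonneg (z t)]) (by linarith)
    have hz : |z t| ≤ 3 :=
      abs_le_of_sq_le_sq (by nlinarith [sq_nonneg (u t), sq_nonneg (v t / a)]) (by linarith)
    rw [abs_div, abs_of_nonneg ha, div_le_iff₀ (by linarith)] at hv
    exact ⟨by linarith, by nlinarith, by linarith⟩

end IsMode

/-- Decay of the modes with initial data `(1, 0)` and `(0, 1)`: parabolic at low frequencies,
exponential at high frequencies. -/
theorem exists_modeFlow_decay {γ : ℝ} (hγ : 1 < γ) : ∃ C c : ℝ, 0 < C ∧ 0 < c ∧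
    ∀ t a : ℝ, 0 ≤ t → 0 < a →
      (a ≤ 2 → |(modeFlow γ (1, 0, 0) t a).1| ≤ C * Real.exp (-c * a * t) ∧
        |(modeFlow γ (0, 1, 0) t a).1| ≤ C * Real.exp (-c * a * t) / √a ∧
        |(modeFlow γ (0, 1, 0) t a).1| ≤ C * t) ∧
      (2 ≤ a → |(modeFlow γ (1, 0, 0) t a).1| ≤ C * Real.exp (-c * t) ∧
        |(modeFlow γ (0, 1, 0) t a).1| ≤ C * Real.exp (-c * t) / a) := by
  have hγ1 : 0 < γ - 1 := by linarith
  have hγ0 : 0 < γ := by linarith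
  set k₁ := (γ - 1) / (48 * γ) with hk₁
  set k₂ := (γ - 1) / (γ + 1) with hk₂
  have hk₁0 : 0 < k₁ := by positivity
  have hk₂0 : 0 < k₂ := by positivity
  -- The square root is the constant of `energy_low`, and `3 = √9` that of `energy_high`.
  set C := √(4 * γ / (γ - 1)) + 3 with hC
  have hs := Real.sqrt_nonneg (4 * γ / (γ - 1))
  have hsq : √(4 * γ / (γ - 1)) ^ 2 = 4 * γ / (γ - 1) := Real.sq_sqrt (by positivity)
  have hC0 : 0 < C := by positivity
  have hCsq : 4 * γ / (γ - 1) ≤ C ^ 2 := by nlinarith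
  have hC9 : 9 ≤ C ^ 2 := by nlinarith
  have hCs : √(4 * γ / (γ - 1)) ≤ C := by linarith
  have hexp2 : ∀ x, Real.exp (-2 * x) = Real.exp (-x) ^ 2 := fun x => by
    rw [← Real.exp_nat_mul]; push_cast; ring_nf
  refine ⟨C, min k₁ k₂, hC0, lt_min hk₁0 hk₂0, fun t a ht ha => ⟨fun ha2 => ?_, fun ha2 => ?_⟩⟩
  · have hle : Real.exp (-(k₁ * a * t)) ≤ Real.exp (-min k₁ k₂ * a * t) := by
      apply Real.exp_le_exp.2
      have := mul_le_mul_of_nonneg_right (min_le_left k₁ k₂) (mul_nonneg ha.le ht)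
      linarith
    have hle1 : ∀ τ, 0 ≤ τ → Real.exp (-(k₁ * a * τ)) ≤ 1 := fun τ hτ =>
      Real.exp_le_one_iff.2 (by have : 0 ≤ k₁ * a * τ := by positivity
                                linarith)
    have e0 := (isMode_modeFlow γ a (1, 0, 0)).energy_low hγ ha.le ha2 (by simp [modeFlow_zero]) ht
    have e1 := fun τ (hτ : 0 ≤ τ) =>
      (isMode_modeFlow γ a (0, 1, 0)).energy_low hγ ha.le ha2 (by simp [modeFlow_zero]) hτ
    have hr : ∀ τ, -2 * k₁ * a * τ = -2 * (k₁ * a * τ) := fun τ => by ring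
    simp only [modeFlow_zero, ← hk₁, hr, hexp2] at e0 e1
    have hx := Real.exp_pos (-(k₁ * a * t))
    refine ⟨?_, ?_, ?_⟩
    · refine (abs_le_of_sq_le_sq ?_ (by positivity : 0 ≤ C * Real.exp (-(k₁ * a * t)))).trans
        (mul_le_mul_of_nonneg_left hle hC0.le)
      rw [mul_pow]
      refine le_of_mul_le_mul_left ?_ ha
      have h1 := mul_le_mul_of_nonneg_right hCsq
        (mul_nonneg (sq_nonneg (Real.exp (-(k₁ * a * t)))) ha.le)
      nlinarith [sq_nonneg (modeFlow γ (1, 0, 0) t a).2.1]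
    · rw [le_div_iff₀ (Real.sqrt_pos.2 ha)]
      refine le_trans ?_ (mul_le_mul_of_nonneg_left hle hC0.le)
      refine le_of_sq_le_sq ?_ (by positivity)
      rw [mul_pow, mul_pow, sq_abs, Real.sq_sqrt ha.le]
      have h1 := mul_le_mul_of_nonneg_right hCsq (sq_nonneg (Real.exp (-(k₁ * a * t))))
      nlinarith [sq_nonneg (modeFlow γ (0, 1, 0) t a).2.1, e1 t ht]
    -- The bound by `C * t` replaces `1/√a` near `a = 0`: the velocity stays bounded by `C` and `u`
    -- starts from `0`.
    · have hv : ∀ τ ∈ Ico 0 t, ‖(modeFlow γ (0, 1, 0) τ a).2.1‖ ≤ C := fun τ hτ => by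
        refine (abs_le_of_sq_le_sq ?_ hC0.le)
        have h1 := mul_nonneg ha.le (sq_nonneg (modeFlow γ (0, 1, 0) τ a).1)
        have h2 := hle1 τ hτ.1
        have h3 := Real.exp_pos (-(k₁ * a * τ))
        have h4 : Real.exp (-(k₁ * a * τ)) ^ 2 ≤ 1 := by nlinarith
        have h5 : 0 ≤ 4 * γ / (γ - 1) := by positivity
        nlinarith [e1 τ hτ.1]
      have := norm_image_sub_le_of_norm_deriv_le_segment'
        (fun τ _ => ((isMode_modeFlow γ a (0, 1, 0)).hasDerivAt_u τ).hasDerivWithinAt) hv t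
        ⟨ht, le_rfl⟩
      simpa [modeFlow_zero] using this
  · have hle : Real.exp (-(k₂ * t)) ≤ Real.exp (-min k₁ k₂ * t) := by
      apply Real.exp_le_exp.2
      have := mul_le_mul_of_nonneg_right (min_le_right k₁ k₂) ht
      linarith
    have e0 := (isMode_modeFlow γ a (1, 0, 0)).energy_high hγ ha2 (by simp [modeFlow_zero]) ht
    have e1 := (isMode_modeFlow γ a (0, 1, 0)).energy_high hγ ha2 (by simp [modeFlow_zero]) ht
    have hr : -2 * k₂ * t = -2 * (k₂ * t) := by ring
    simp only [modeFlow_zero, ← hk₂, hr, hexp2] at e0 e1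
    have h1 := mul_le_mul_of_nonneg_right hC9 (sq_nonneg (Real.exp (-(k₂ * t))))
    constructor
    · refine (abs_le_of_sq_le_sq ?_ (by positivity : 0 ≤ C * Real.exp (-(k₂ * t)))).trans
        (mul_le_mul_of_nonneg_left hle hC0.le)
      norm_num at e0
      nlinarith [sq_nonneg ((modeFlow γ (1, 0, 0) t a).2.1 / a),
        sq_nonneg (modeFlow γ (1, 0, 0) t a).2.2]
    · refine (abs_le_of_sq_le_sq ?_ (by positivity : 0 ≤ C * Real.exp (-(k₂ * t)) / a)).trans
        (div_le_div_of_nonneg_right (mul_le_mul_of_nonneg_left hle hC0.le) ha.le)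
      rw [div_pow, mul_pow]
      have h2 := mul_le_mul_of_nonneg_right h1 (sq_nonneg (1 / a))
      have h3 : C ^ 2 * Real.exp (-(k₂ * t)) ^ 2 / a ^ 2
        = C ^ 2 * Real.exp (-(k₂ * t)) ^ 2 * (1 / a) ^ 2 := by field_simp
      rw [h3]
      nlinarith [sq_nonneg ((modeFlow γ (0, 1, 0) t a).2.1 / a),
        sq_nonneg (modeFlow γ (0, 1, 0) t a).2.2]

/-! ### `L²` norms of radial majorants -/

/-- `f` is square integrable with `L²` norm at most `B`. -/
def L2Bound {n : ℕ} {F : Type*} [NormedAddCommGroup F] (f : Rn n → F) (B : ℝ) : Prop :=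
  MemLp f 2 volume ∧ eLpNorm f 2 volume ≤ ENNReal.ofReal B

namespace L2Bound

variable {n : ℕ} {F G : Type*} [NormedAddCommGroup F] [NormedAddCommGroup G]
  {f g : Rn n → ℝ} {A B : ℝ}

theorem add (hf : L2Bound f A) (hg : L2Bound g B) (hA : 0 ≤ A) (hB : 0 ≤ B) :
    L2Bound (fun ξ => f ξ + g ξ) (A + B) := by
  refine ⟨hf.1.add hg.1, (eLpNorm_add_le hf.1.1 hg.1.1 (by norm_num)).trans ?_⟩
  rw [ENNReal.ofReal_add hA hB]
  exact add_le_add hf.2 hg.2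

theorem const_mul (hf : L2Bound f A) {c : ℝ} (hc : 0 ≤ c) :
    L2Bound (fun ξ => c * f ξ) (c * A) := by
  refine ⟨hf.1.const_mul c, ?_⟩
  have := eLpNorm_const_smul (μ := volume) (p := 2) c f
  rw [ENNReal.ofReal_mul hc]
  refine (le_of_eq (this.trans ?_)).trans (mul_le_mul_right hf.2 _)
  rw [Real.enorm_of_nonneg hc]

theorem mono {h : Rn n → G} (hf : L2Bound h A) (hAB : A ≤ B) : L2Bound h B :=
  ⟨hf.1, hf.2.trans (ENNReal.ofReal_le_ofReal hAB)⟩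

theorem of_ae_le {h : Rn n → G} (hf : L2Bound f A) (hm : AEStronglyMeasurable h volume)
    (hle : ∀ᵐ ξ, ‖h ξ‖ ≤ f ξ) : L2Bound h A := by
  have hle' : ∀ᵐ ξ, ‖h ξ‖ ≤ ‖f ξ‖ := hle.mono fun ξ hξ => hξ.trans (le_abs_self _)
  exact ⟨hf.1.of_le hm hle', (eLpNorm_mono_ae hle').trans hf.2⟩

end L2Bound

/-- The `L²` norm of a radial function, in polar coordinates. -/
theorem exists_l2Bound_radial {n : ℕ} (hn : 1 ≤ n) : ∃ κ : ℝ, 0 ≤ κ ∧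
    ∀ (F G : ℝ → ℝ) (I : ℝ), Measurable F → IntegrableOn G (Ioi 0) → ∫ y in Ioi 0, G y ≤ I →
      (∀ y, 0 < y → y ^ ((n : ℝ) - 1) * F y ^ 2 ≤ G y) →
      L2Bound (fun ξ : Rn n => F ‖ξ‖) (κ * √I) := by
  have : Nonempty (Fin n) := ⟨⟨0, hn⟩⟩
  have : Nontrivial (Rn n) := inferInstance
  set V : ℝ := n * (volume : Measure (Rn n)).real (Metric.ball 0 1) with hV
  have hV0 : 0 ≤ V := by positivity
  refine ⟨√V, Real.sqrt_nonneg _, fun F G I hF hG hI hle => ?_⟩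
  have hpow : ∀ y : ℝ, y ^ ((n : ℝ) - 1) = y ^ (n - 1) := fun y => by
    rw [← Real.rpow_natCast, Nat.cast_sub hn, Nat.cast_one]
  simp only [hpow] at hle
  have hint : IntegrableOn (fun y : ℝ => y ^ (n - 1) * F y ^ 2) (Ioi 0) := by
    refine hG.mono' (by fun_prop) ?_
    filter_upwards [ae_restrict_mem measurableSet_Ioi] with y hy
    have : 0 ≤ y ^ (n - 1) * F y ^ 2 := mul_nonneg (pow_nonneg (le_of_lt hy) _) (sq_nonneg _)
    rw [Real.norm_of_nonneg this]
    exact hle y hy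
  have hsq : Integrable (fun ξ : Rn n => F ‖ξ‖ ^ 2) := by
    have := (integrable_fun_norm_addHaar (E := Rn n) volume (f := fun y => F y ^ 2)).2
      (by simpa using hint)
    exact this
  have hmeas : AEStronglyMeasurable (fun ξ : Rn n => F ‖ξ‖) volume :=
    (hF.comp measurable_norm).aestronglyMeasurable
  have hmem : MemLp (fun ξ : Rn n => F ‖ξ‖) 2 volume := (memLp_two_iff_integrable_sq hmeas).2 hsq
  refine ⟨hmem, ?_⟩
  have hval : ∫ ξ : Rn n, F ‖ξ‖ ^ 2 ≤ V * I := by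
    have := integral_fun_norm_addHaar (E := Rn n) volume (fun y => F y ^ 2)
    rw [this]
    simp only [finrank_euclideanSpace, Fintype.card_fin, smul_eq_mul, nsmul_eq_mul, ← mul_assoc]
    rw [← hV]
    refine mul_le_mul_of_nonneg_left (le_trans ?_ hI) hV0
    exact setIntegral_mono_on hint hG measurableSet_Ioi fun y hy => hle y hy
  rw [hmem.eLpNorm_eq_integral_rpow_norm (by norm_num) (by norm_num)]
  apply ENNReal.ofReal_le_ofReal
  rw [← Real.sqrt_mul hV0]
  simp only [ENNReal.toReal_ofNat, Real.rpow_ofNat, Real.norm_eq_abs, sq_abs]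
  rw [← one_div, ← Real.sqrt_eq_rpow]
  exact Real.sqrt_le_sqrt hval

theorem exists_l2Bound_rpow_mul_exp {n : ℕ} (hn : 1 ≤ n) {σ c : ℝ} (hσ : -(n : ℝ) / 2 < σ)
    (hc : 0 < c) (R : ℝ) : ∃ C : ℝ, 0 ≤ C ∧ ∀ t : ℝ, 0 ≤ t →
      L2Bound (fun ξ : Rn n => if ‖ξ‖ ≤ R then ‖ξ‖ ^ σ * Real.exp (-c * ‖ξ‖ ^ 2 * t) else 0)
        (C * (1 + t) ^ (-σ / 2 - (n : ℝ) / 4)) := by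
  obtain ⟨κ, hκ, hrad⟩ := exists_l2Bound_radial hn
  set q : ℝ := n - 1 + 2 * σ with hq
  have hq1 : -1 < q := by linarith
  -- On the ball of radius `R` the factor `D` pays for replacing `t` by `1 + t` in the Gaussian, so
  -- one Gamma integral covers all `t ≥ 0`, including `t = 0`.
  set D : ℝ := Real.exp (2 * c * R ^ 2) with hD
  set K : ℝ := D * ((2 * c) ^ (-(q + 1) / 2) * (1 / 2) * Real.Gamma ((q + 1) / 2)) with hK
  have hΓ := Real.Gamma_pos_of_pos (by linarith : 0 < (q + 1) / 2)
  have hK0 : 0 ≤ K := by positivity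
  refine ⟨κ * √K, by positivity, fun t ht => ?_⟩
  have hT : 0 < 1 + t := by linarith
  have hb : 0 < 2 * c * (1 + t) := by positivity
  have hint := (integrableOn_rpow_mul_exp_neg_mul_rpow hq1 (by norm_num : (0:ℝ) < 2) hb)
  have hval := integral_rpow_mul_exp_neg_mul_rpow (by norm_num : (0:ℝ) < 2) hq1 hb
  refine (hrad (fun y => if y ≤ R then y ^ σ * Real.exp (-c * y ^ 2 * t) else 0)
    (fun y => D * (y ^ q * Real.exp (-(2 * c * (1 + t)) * y ^ (2:ℝ))))
    (K * (1 + t) ^ (-(q + 1) / 2)) ?_ (hint.const_mul D) ?_ ?_).mono ?_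
  · exact Measurable.ite measurableSet_Iic (by fun_prop) measurable_const
  · rw [integral_const_mul, hval, Real.mul_rpow (by positivity) hT.le]
    apply le_of_eq
    rw [hK]; ring
  · intro y hy
    split_ifs with hyR
    · have h1 : y ^ ((n:ℝ) - 1) * (y ^ σ * Real.exp (-c * y ^ 2 * t)) ^ 2
          = y ^ q * Real.exp (-2 * c * y ^ 2 * t) := by
        rw [mul_pow, ← Real.exp_nat_mul, ← Real.rpow_natCast (y ^ σ), ← Real.rpow_mul hy.le,
          ← mul_assoc, ← Real.rpow_add hy, hq]
        push_cast
        ring_nf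
      rw [h1, mul_left_comm]
      refine mul_le_mul_of_nonneg_left ?_ (Real.rpow_nonneg hy.le _)
      rw [hD, ← Real.exp_add]
      apply Real.exp_le_exp.2
      rw [Real.rpow_two]
      have : y ^ 2 ≤ R ^ 2 := pow_le_pow_left₀ hy.le hyR 2
      nlinarith
    · have := Real.rpow_nonneg hy.le q
      rw [zero_pow two_ne_zero, mul_zero]
      positivity
  · apply le_of_eq
    rw [Real.sqrt_mul hK0, Real.sqrt_eq_rpow ((1 + t) ^ (-(q + 1) / 2)), ← Real.rpow_mul hT.le,
      mul_assoc]
    congr 3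
    rw [hq]; ring

/-- The splitting of `∫₀^∞ y^{m-1} min(T, 1/y)² 1_S dy` at `y = 1/T`. -/
theorem rpow_mul_min_sq_le {n : ℕ} {s T y : ℝ} (hT : 0 < T) (hy : 0 < y) :
    y ^ ((n : ℝ) - 1) * (y ^ s * min T (1 / y)) ^ 2 ≤
      if y ≤ 1 / T then T ^ 2 * y ^ (2 * s + n - 1) else y ^ (2 * s + n - 3) := by
  have hmin : 0 ≤ min T (1 / y) := le_min hT.le (by positivity)
  have h1 : y ^ ((n:ℝ) - 1) * (y ^ s * min T (1 / y)) ^ 2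
      = y ^ (2 * s + n - 1) * min T (1 / y) ^ 2 := by
    rw [mul_pow, ← Real.rpow_natCast (y ^ s), ← Real.rpow_mul hy.le, ← mul_assoc,
      ← Real.rpow_add hy]
    congr 2
    push_cast; ring
  have hp := Real.rpow_nonneg hy.le (2 * s + n - 1)
  rw [h1]
  split_ifs with h
  · rw [mul_comm]
    exact mul_le_mul_of_nonneg_right (pow_le_pow_left₀ hmin (min_le_left _ _) 2) hp
  · refine (mul_le_mul_of_nonneg_left (pow_le_pow_left₀ hmin (min_le_right _ _) 2) hp).trans
      (le_of_eq ?_)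
    rw [one_div, ← Real.rpow_neg_one, ← Real.rpow_natCast (y ^ (-1 : ℝ)), ← Real.rpow_mul hy.le,
      ← Real.rpow_add hy]
    congr 1
    push_cast; ring

theorem integrableOn_and_integral_sq_mul_rpow {m T : ℝ} (hm : 0 < m) (hT : 0 < T) :
    IntegrableOn (fun y : ℝ => T ^ 2 * y ^ (m - 1)) (Ioc 0 (1 / T)) ∧
      ∫ y in Ioc 0 (1 / T), T ^ 2 * y ^ (m - 1) = T ^ (2 - m) / m := by
  have hT' : 0 ≤ 1 / T := by positivity
  constructor
  · exact ((intervalIntegrable_iff_integrableOn_Ioc_of_le hT').1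
      (intervalIntegral.intervalIntegrable_rpow' (by linarith : -1 < m - 1))).const_mul _
  · rw [← intervalIntegral.integral_of_le hT', intervalIntegral.integral_const_mul,
      integral_rpow (Or.inl (by linarith : -1 < m - 1)), sub_add_cancel,
      Real.zero_rpow hm.ne', sub_zero, one_div, Real.inv_rpow hT.le, Real.rpow_sub hT,
      Real.rpow_two]
    ring

/-- With `m = 2s + n`, both halves of the split integral scale like `T^{2-m}`: the inner one
converges since `m > 0`, the outer one since `m < 2`. No frequency cutoff is needed. -/
theorem exists_l2Bound_rpow_mul_min {n : ℕ} (hn : 1 ≤ n) {s : ℝ} (hs : 0 ≤ s)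
    (hm : 2 * s + n < 2) : ∃ C : ℝ, 0 ≤ C ∧ ∀ T : ℝ, 1 ≤ T →
      L2Bound (fun ξ : Rn n => ‖ξ‖ ^ s * min T (1 / ‖ξ‖)) (C * T ^ (1 - s - (n : ℝ) / 2)) := by
  obtain ⟨κ, hκ, hrad⟩ := exists_l2Bound_radial hn
  set m : ℝ := 2 * s + n with hmdef
  have hn' : (1 : ℝ) ≤ n := by exact_mod_cast hn
  have hm0 : 0 < m := by linarith
  have hm2 : 0 < 2 - m := by linarith
  refine ⟨κ * √(1 / m + 1 / (2 - m)), by positivity, fun T hT1 => ?_⟩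
  have hT : 0 < T := by linarith
  obtain ⟨hi1, hv1⟩ := integrableOn_and_integral_sq_mul_rpow hm0 hT
  have hT' : 0 < 1 / T := by positivity
  have hi2 : IntegrableOn (fun y : ℝ => y ^ (m - 3)) (Ioi (1 / T)) :=
    integrableOn_Ioi_rpow_of_lt (by linarith) hT'
  have hv2 : ∫ y in Ioi (1 / T), y ^ (m - 3) = T ^ (2 - m) / (2 - m) := by
    rw [integral_Ioi_rpow_of_lt (by linarith) hT', one_div, Real.inv_rpow hT.le,
      ← Real.rpow_neg hT.le]
    rw [show m - 3 + 1 = -(2 - m) by ring, neg_neg, neg_div_neg_eq]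
  set G : ℝ → ℝ := fun y => if y ≤ 1 / T then T ^ 2 * y ^ (m - 1) else y ^ (m - 3) with hG
  have e1 : EqOn G (fun y => T ^ 2 * y ^ (m - 1)) (Ioc 0 (1 / T)) := fun y hy => if_pos hy.2
  have e2 : EqOn G (fun y => y ^ (m - 3)) (Ioi (1 / T)) := fun y hy => if_neg (not_le.2 hy)
  have j1 : IntegrableOn G (Ioc 0 (1 / T)) := hi1.congr_fun e1.symm measurableSet_Ioc
  have j2 : IntegrableOn G (Ioi (1 / T)) := hi2.congr_fun e2.symm measurableSet_Ioi
  have hU : Ioc 0 (1 / T) ∪ Ioi (1 / T) = Ioi 0 := Ioc_union_Ioi_eq_Ioi hT'.le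
  refine (hrad (fun y => y ^ s * min T (1 / y)) G ((1 / m + 1 / (2 - m)) * T ^ (2 - m))
    (by fun_prop) (hU ▸ j1.union j2) ?_ fun y hy => rpow_mul_min_sq_le hT hy).mono ?_
  · rw [← hU, setIntegral_union (Ioc_disjoint_Ioi le_rfl) measurableSet_Ioi j1 j2,
      setIntegral_congr_fun measurableSet_Ioc e1, setIntegral_congr_fun measurableSet_Ioi e2,
      hv1, hv2]
    apply le_of_eq; ring
  · apply le_of_eq
    rw [Real.sqrt_mul (by positivity), Real.sqrt_eq_rpow (T ^ (2 - m)), ← Real.rpow_mul hT.le,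
      mul_assoc]
    congr 3
    rw [hmdef]; ring

/-- At the critical value the outer integrand is `1/y`; it requires the cutoff at `R` and produces
`log R + log T`. -/
theorem exists_l2Bound_rpow_mul_min_log {n : ℕ} (hn : 1 ≤ n) {s : ℝ}
    (hm : 2 * s + n = 2) {R : ℝ} (hR : 1 ≤ R) : ∃ C : ℝ, 0 ≤ C ∧ ∀ t : ℝ, 0 ≤ t →
      L2Bound (fun ξ : Rn n => if ‖ξ‖ ≤ R then ‖ξ‖ ^ s * min (1 + t) (1 / ‖ξ‖) else 0)
        (C * Real.log (Real.exp 1 + t) ^ (1 / 2 : ℝ)) := by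
  obtain ⟨κ, hκ, hrad⟩ := exists_l2Bound_radial hn
  have hlogR : 0 ≤ Real.log R := Real.log_nonneg hR
  refine ⟨κ * √(Real.log R + 2), by positivity, fun t ht => ?_⟩
  set T := 1 + t with hTdef
  have hT : 0 < T := by linarith
  have hT' : 0 < 1 / T := by positivity
  have hTR : 1 / T ≤ R := ((div_le_one hT).2 (by linarith)).trans hR
  obtain ⟨hi1, hv1⟩ := integrableOn_and_integral_sq_mul_rpow two_pos hT
  have hii : IntervalIntegrable (fun y : ℝ => y⁻¹) volume (1 / T) R := by
    apply intervalIntegrable_inv_iff.2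
    right
    rw [uIcc_of_le hTR]
    exact fun h => absurd h.1 (not_le.2 hT')
  have hi2 : IntegrableOn (fun y : ℝ => y⁻¹) (Ioc (1 / T) R) :=
    (intervalIntegrable_iff_integrableOn_Ioc_of_le hTR).1 hii
  have hv2 : ∫ y in Ioc (1 / T) R, y⁻¹ = Real.log R + Real.log T := by
    rw [← intervalIntegral.integral_of_le hTR, integral_inv_of_pos hT' (by linarith), one_div,
      div_inv_eq_mul, Real.log_mul (by linarith) hT.ne']
  set G : ℝ → ℝ := fun y => if y ≤ 1 / T then T ^ 2 * y ^ ((2:ℝ) - 1) else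
    if y ≤ R then y⁻¹ else 0 with hG
  have e1 : EqOn G (fun y => T ^ 2 * y ^ ((2:ℝ) - 1)) (Ioc 0 (1 / T)) := fun y hy => if_pos hy.2
  have e2 : EqOn G (fun y => y⁻¹) (Ioc (1 / T) R) := fun y hy => by
    simp only [hG]
    rw [if_neg (not_le.2 hy.1), if_pos hy.2]
  have e3 : EqOn G (fun _ => 0) (Ioi R) := fun y hy => by
    simp only [hG]
    rw [if_neg (not_le.2 (hTR.trans_lt hy)), if_neg (not_le.2 hy)]
  have j1 : IntegrableOn G (Ioc 0 (1 / T)) := hi1.congr_fun e1.symm measurableSet_Ioc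
  have j2 : IntegrableOn G (Ioc (1 / T) R) := hi2.congr_fun e2.symm measurableSet_Ioc
  have j3 : IntegrableOn G (Ioi R) := integrableOn_zero.congr_fun e3.symm measurableSet_Ioi
  have hU : Ioc 0 (1 / T) ∪ Ioi (1 / T) = Ioi 0 := Ioc_union_Ioi_eq_Ioi hT'.le
  have hU2 : Ioc (1 / T) R ∪ Ioi R = Ioi (1 / T) := Ioc_union_Ioi_eq_Ioi hTR
  have j4 : IntegrableOn G (Ioi (1 / T)) := hU2 ▸ j2.union j3
  have he : Real.exp 1 + t ≥ T := by
    have := Real.add_one_le_exp (1 : ℝ); linarith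
  have hlogT : Real.log T ≤ Real.log (Real.exp 1 + t) := Real.log_le_log hT he
  have hlog1 : 1 ≤ Real.log (Real.exp 1 + t) := by
    rw [Real.le_log_iff_exp_le (by positivity)]; linarith
  refine (hrad (fun y => if y ≤ R then y ^ s * min T (1 / y) else 0) G
    ((Real.log R + 2) * Real.log (Real.exp 1 + t))
    (Measurable.ite measurableSet_Iic (by fun_prop) measurable_const)
    (hU ▸ j1.union j4) ?_ fun y hy => ?_).mono ?_
  · rw [← hU, setIntegral_union (Ioc_disjoint_Ioi le_rfl) measurableSet_Ioi j1 j4,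
      setIntegral_congr_fun measurableSet_Ioc e1, hv1, ← hU2,
      setIntegral_union (Ioc_disjoint_Ioi le_rfl) measurableSet_Ioi j2 j3,
      setIntegral_congr_fun measurableSet_Ioc e2, setIntegral_congr_fun measurableSet_Ioi e3, hv2]
    simp only [sub_self, Real.rpow_zero, integral_zero, add_zero]
    nlinarith
  · simp only [hG]
    by_cases hyR : y ≤ R
    · rw [if_pos hyR, if_pos hyR]
      refine (rpow_mul_min_sq_le hT hy).trans (le_of_eq ?_)
      rw [hm, show (2:ℝ) - 3 = -1 by norm_num, Real.rpow_neg_one]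
    · rw [if_neg hyR, if_neg hyR, if_neg (fun h => hyR (h.trans hTR))]
      simp
  · apply le_of_eq
    rw [Real.sqrt_mul (by positivity), Real.sqrt_eq_rpow (Real.log (Real.exp 1 + t)), mul_assoc]

/-! ### Fourier description of the Laplacian, the pairing and the data -/

variable {n : ℕ}

/-- The symbol `|ξ|²` of `-Δ`; in Mathlib's normalisation the frequency variable is `2π ξ`. -/
noncomputable def laplaceSymbol (ξ : Rn n) : ℝ := (2 * Real.pi * ‖ξ‖) ^ 2

theorem laplaceSymbol_nonneg (ξ : Rn n) : 0 ≤ laplaceSymbol ξ := sq_nonneg _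

@[fun_prop]
theorem continuous_laplaceSymbol : Continuous (laplaceSymbol (n := n)) := by
  unfold laplaceSymbol
  fun_prop

/-- This moves every pairing to the frequency side, where a solution is a superposition of modes and
`Δ` multiplies `𝓕⁻ φ` by minus the symbol. -/
theorem toDist_apply_eq_integral_fourierInv (f : L2 n) (φ : 𝓢(Rn n, ℂ)) :
    toDist f φ = ∫ ξ, (𝓕⁻ φ) ξ * (𝓕 f : L2 n) ξ := by
  have h := Lp.fourierInv_toTemperedDistribution_eq (𝓕 f : L2 n)
  rw [fourierInv_fourier_eq] at h
  rw [toDist, ← h, TemperedDistribution.fourierInv_apply, Lp.toTemperedDistribution_apply]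
  rfl

theorem fourierInv_laplacian_apply (φ : 𝓢(Rn n, ℂ)) (ξ : Rn n) :
    (𝓕⁻ (Δ φ)) ξ = -(laplaceSymbol ξ : ℂ) * (𝓕⁻ φ) ξ := by
  have h : 𝓕 (Δ φ) = -((2 * Real.pi) ^ 2 : ℝ) •
      SchwartzMap.smulLeftCLM ℂ (fun x : Rn n => ‖x‖ ^ 2) (𝓕 φ) := by
    rw [SchwartzMap.laplacian_eq_fourierMultiplierCLM, SchwartzMap.fourierMultiplierCLM_apply]
    have := FourierTransform.fourier_smul (R := ℂ) (((-(2 * Real.pi) ^ 2 : ℝ)) : ℂ)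
      (𝓕⁻ (SchwartzMap.smulLeftCLM ℂ (fun x : Rn n => ‖x‖ ^ 2) (𝓕 φ)))
    rw [fourier_fourierInv_eq] at this
    exact this
  have hneg : ∀ ψ : 𝓢(Rn n, ℂ), (𝓕⁻ ψ) ξ = (𝓕 ψ) (-ξ) := fun ψ => by
    rw [SchwartzMap.fourierInv_coe, SchwartzMap.fourier_coe, Real.fourierInv_eq_fourier_neg]
  rw [hneg, hneg, h, smul_apply,
    SchwartzMap.smulLeftCLM_apply_apply (by fun_prop)]
  simp only [norm_neg, laplaceSymbol, Complex.real_smul]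
  push_cast
  ring

/-- Compactly supported tests suffice, and uniqueness needs this: there only band-limited test
functions are available. -/
theorem ae_eq_of_forall_integral_schwartz_mul {f g : Rn n → ℂ} (hf : LocallyIntegrable f volume)
    (hg : LocallyIntegrable g volume)
    (h : ∀ φ : 𝓢(Rn n, ℂ), HasCompactSupport φ → ∫ x, φ x * f x = ∫ x, φ x * g x) :
    f =ᵐ[volume] g := by
  refine ae_eq_of_integral_contDiff_smul_eq hf hg fun η hη hc => ?_
  have hg₁ : HasCompactSupport (Complex.ofRealCLM ∘ η) := hc.comp_left rfl
  have hg₂ : ContDiff ℝ (⊤ : ℕ∞) (Complex.ofRealCLM ∘ η) := by fun_prop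
  simpa using h (hg₁.toSchwartzMap hg₂) (by simpa using! hg₁)

theorem Lp.fourier_ae_eq_fourier_of_integrable (f : L2 n) (hf : Integrable f) :
    (𝓕 f : L2 n) =ᵐ[volume] 𝓕 (f : Rn n → ℂ) := by
  have hcont : Continuous (𝓕 (f : Rn n → ℂ)) :=
    VectorFourier.fourierIntegral_continuous Real.continuous_fourierChar
      (by exact continuous_inner) hf
  refine ae_eq_of_forall_integral_schwartz_mul
    ((Lp.memLp (𝓕 f : L2 n)).locallyIntegrable (by norm_num)) hcont.locallyIntegrable
    fun φ _ => ?_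
  have h1 := congrArg (fun T => T φ) (Lp.fourier_toTemperedDistribution_eq f)
  simp only [TemperedDistribution.fourier_apply, Lp.toTemperedDistribution_apply,
    smul_eq_mul] at h1
  rw [← h1]
  have h2 := VectorFourier.integral_fourierIntegral_smul_eq_flip (μ := volume) (ν := volume)
    (L := innerₗ (Rn n)) (f := (φ : Rn n → ℂ)) (g := (f : Rn n → ℂ))
    Real.continuous_fourierChar continuous_inner φ.integrable hf
  rw [flip_innerₗ] at h2
  simpa [SchwartzMap.fourier_coe] using! h2

/-- `|û(ξ)| ≤ |P| + |ξ| ‖u‖_{L^{1,1}}`. -/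
theorem ae_norm_fourier_le (f : L2 n) (hf : MemL11 f) :
    ∀ᵐ ξ : Rn n, ‖(𝓕 f : L2 n) ξ‖ ≤ ‖totalIntegral f‖ + 2 * Real.pi * ‖ξ‖ * normL11 f := by
  filter_upwards [Lp.fourier_ae_eq_fourier_of_integrable f hf.1] with ξ hξ
  rw [hξ]
  have hint : Integrable (fun x : Rn n => Real.fourierChar (-(inner ℝ x ξ)) • f x) := by
    have := (Real.fourierIntegral_convergent_iff (μ := volume) (f := (f : Rn n → ℂ)) ξ).2 hf.1
    exact this
  -- `P_f` is the value of the transform at `0`; the difference is estimated by `|e^{iθ} - 1| ≤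
  -- |θ|`, and the factor `|x|` is absorbed by the weight.
  have hdiff : 𝓕 (f : Rn n → ℂ) ξ - totalIntegral f
      = ∫ x, (Real.fourierChar (-(inner ℝ x ξ)) • f x - f x) := by
    rw [integral_sub hint hf.1, Real.fourier_eq]
    rfl
  have hb : ‖𝓕 (f : Rn n → ℂ) ξ - totalIntegral f‖ ≤ 2 * Real.pi * ‖ξ‖ * normL11 f := by
    rw [hdiff, normL11, ← integral_const_mul]
    refine norm_integral_le_of_norm_le (hf.2.const_mul _) (ae_of_all _ fun x => ?_)
    have h1 : Real.fourierChar (-(inner ℝ x ξ)) • f x - f x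
        = (Complex.exp (Complex.I * (2 * Real.pi * -(inner ℝ x ξ) : ℝ)) - 1) * f x := by
      rw [Circle.smul_def, Real.fourierChar_apply, smul_eq_mul, sub_mul, one_mul]
      congr 3
      push_cast
      ring
    rw [h1, norm_mul]
    have h2 := Real.norm_exp_I_mul_ofReal_sub_one_le (x := 2 * Real.pi * -(inner ℝ x ξ))
    have h3 : ‖2 * Real.pi * -(inner ℝ x ξ)‖ ≤ 2 * Real.pi * ‖ξ‖ * (1 + ‖x‖) := by
      rw [norm_mul, norm_neg, Real.norm_of_nonneg (by positivity : 0 ≤ 2 * Real.pi)]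
      have h4 := norm_inner_le_norm (𝕜 := ℝ) x ξ
      have : ‖x‖ * ‖ξ‖ ≤ ‖ξ‖ * (1 + ‖x‖) := by nlinarith [norm_nonneg ξ, norm_nonneg x]
      rw [mul_assoc (2 * Real.pi)]
      exact mul_le_mul_of_nonneg_left (h4.trans this) (by positivity)
    calc _ ≤ 2 * Real.pi * ‖ξ‖ * (1 + ‖x‖) * ‖f x‖ :=
          mul_le_mul_of_nonneg_right (h2.trans h3) (norm_nonneg _)
      _ = _ := by ring
  calc ‖𝓕 (f : Rn n → ℂ) ξ‖ = ‖totalIntegral f + (𝓕 (f : Rn n → ℂ) ξ - totalIntegral f)‖ := by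
        congr 1; ring
    _ ≤ _ := (norm_add_le _ _).trans (by linarith)

theorem normL11_nonneg (f : L2 n) : 0 ≤ normL11 f :=
  integral_nonneg fun x => mul_nonneg (by positivity) (norm_nonneg _)

theorem normH_nonneg (s : ℝ) (f : L2 n) : 0 ≤ normH s f := ENNReal.toReal_nonneg

/-- Membership gives square integrability with the weight `(1 + |ξ|²)^{s/2}`, whereas `normH` uses
the frequency `2πξ`. The weights differ by at most the factor `(2π)^s`, so the norm is finite and
`toReal` loses nothing. -/
theorem l2Bound_of_memH {s : ℝ} (hs : 0 ≤ s) {f : L2 n} (hf : MemH s f) :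
    L2Bound (fun ξ : Rn n => (1 + laplaceSymbol ξ) ^ (s / 2) * ‖(𝓕 f : L2 n) ξ‖) (normH s f) := by
  obtain ⟨g, hg⟩ := TemperedDistribution.memSobolev_iff_exists_smulLeftCLM_fourier.1 hf
  rw [Lp.fourier_toTemperedDistribution_eq] at hg
  have hgrowth : (fun x : Rn n => (((1 + ‖x‖ ^ 2) ^ (s / 2) : ℝ) : ℂ)).HasTemperateGrowth := by
    fun_prop
  have hw : Continuous fun x : Rn n => (((1 + ‖x‖ ^ 2) ^ (s / 2) : ℝ) : ℂ) :=
    hgrowth.1.continuous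
  have hae : (fun x : Rn n => (((1 + ‖x‖ ^ 2) ^ (s / 2) : ℝ) : ℂ) * (𝓕 f : L2 n) x)
      =ᵐ[volume] g := by
    have hloc : LocallyIntegrable (𝓕 f : L2 n) volume :=
      (Lp.memLp (𝓕 f : L2 n)).locallyIntegrable (by norm_num)
    refine ae_eq_of_forall_integral_schwartz_mul ?_
      ((Lp.memLp g).locallyIntegrable (by norm_num)) fun φ _ => ?_
    · rw [← locallyIntegrableOn_univ] at hloc ⊢
      exact hloc.continuousOn_mul hw.continuousOn isOpen_univ.isLocallyClosed
    · have h1 := congrArg (fun T => T φ) hg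
      simp only [TemperedDistribution.smulLeftCLM_apply_apply,
        Lp.toTemperedDistribution_apply, smul_eq_mul,
        SchwartzMap.smulLeftCLM_apply_apply hgrowth] at h1
      rw [← h1]
      congr 1
      ext x
      ring
  have hmeas : AEStronglyMeasurable (fun ξ : Rn n =>
      (((1 + laplaceSymbol ξ) ^ (s / 2) : ℝ) : ℂ) * (𝓕 f : L2 n) ξ) volume := by
    refine AEStronglyMeasurable.mul (Continuous.aestronglyMeasurable ?_)
      (Lp.aestronglyMeasurable _)
    refine Complex.continuous_ofReal.comp (Continuous.rpow_const (by fun_prop) fun ξ => Or.inl ?_)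
    have := laplaceSymbol_nonneg ξ
    positivity
  have hmem : MemLp (fun ξ : Rn n =>
      (((1 + laplaceSymbol ξ) ^ (s / 2) : ℝ) : ℂ) * (𝓕 f : L2 n) ξ) 2 volume := by
    refine ((Lp.memLp g).const_mul ((((2 * Real.pi) ^ 2) ^ (s / 2) : ℝ) : ℂ)).of_le hmeas ?_
    filter_upwards [hae] with ξ hξ
    rw [← hξ, norm_mul, norm_mul, norm_mul, ← mul_assoc]
    refine mul_le_mul_of_nonneg_right ?_ (norm_nonneg _)
    have h0 := laplaceSymbol_nonneg ξ
    simp only [Complex.norm_real]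
    rw [Real.norm_of_nonneg (by positivity), Real.norm_of_nonneg (by positivity),
      Real.norm_of_nonneg (by positivity), ← Real.mul_rpow (by positivity) (by positivity)]
    refine Real.rpow_le_rpow (by positivity) ?_ (by positivity)
    have hπ : 1 ≤ (2 * Real.pi) ^ 2 := by nlinarith [Real.pi_gt_three]
    rw [laplaceSymbol, mul_pow]
    nlinarith
  have hnorm : (fun ξ : Rn n => (1 + laplaceSymbol ξ) ^ (s / 2) * ‖(𝓕 f : L2 n) ξ‖) =
      fun ξ => ‖(((1 + laplaceSymbol ξ) ^ (s / 2) : ℝ) : ℂ) * (𝓕 f : L2 n) ξ‖ := by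
    ext ξ
    have h0 := laplaceSymbol_nonneg ξ
    rw [norm_mul, Complex.norm_real, Real.norm_of_nonneg (by positivity)]
  rw [hnorm]
  refine ⟨hmem.norm, ?_⟩
  rw [eLpNorm_norm, normH]
  simp only [laplaceSymbol] at hmem ⊢
  rw [ENNReal.ofReal_toReal hmem.2.ne]

/-! ### Parameter integrals on `[0, ∞)` -/

/-- `H t` is dominated by an integrable function, locally uniformly in `t ≥ 0`. -/
structure LocallyDominated {α E : Type*} [MeasurableSpace α] [NormedAddCommGroup E]
    (μ : Measure α) (H : ℝ → α → E) : Prop where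
  aestronglyMeasurable : ∀ t, 0 ≤ t → AEStronglyMeasurable (H t) μ
  exists_bound : ∀ T : ℝ, ∃ b : α → ℝ, Integrable b μ ∧
    ∀ t, 0 ≤ t → t ≤ T → ∀ x, ‖H t x‖ ≤ b x

namespace LocallyDominated

variable {α E : Type*} [MeasurableSpace α] [NormedAddCommGroup E] {μ : Measure α}
  {H H' : ℝ → α → E}

theorem integrable (h : LocallyDominated μ H) {t : ℝ} (ht : 0 ≤ t) : Integrable (H t) μ := by
  obtain ⟨b, hb, hle⟩ := h.exists_bound t
  exact hb.mono' (h.aestronglyMeasurable t ht) (ae_of_all _ fun x => hle t ht le_rfl x)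

theorem add (h : LocallyDominated μ H) (h' : LocallyDominated μ H') :
    LocallyDominated μ (fun t x => H t x + H' t x) where
  aestronglyMeasurable t ht := (h.1 t ht).add (h'.1 t ht)
  exists_bound T := by
    obtain ⟨b, hb, hle⟩ := h.exists_bound T
    obtain ⟨b', hb', hle'⟩ := h'.exists_bound T
    exact ⟨b + b', hb.add hb', fun t ht htT x =>
      (norm_add_le _ _).trans (add_le_add (hle t ht htT x) (hle' t ht htT x))⟩

theorem sub (h : LocallyDominated μ H) (h' : LocallyDominated μ H') :
    LocallyDominated μ (fun t x => H t x - H' t x) where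
  aestronglyMeasurable t ht := (h.1 t ht).sub (h'.1 t ht)
  exists_bound T := by
    obtain ⟨b, hb, hle⟩ := h.exists_bound T
    obtain ⟨b', hb', hle'⟩ := h'.exists_bound T
    exact ⟨b + b', hb.add hb', fun t ht htT x =>
      (norm_sub_le _ _).trans (add_le_add (hle t ht htT x) (hle' t ht htT x))⟩

theorem const_smul [NormedSpace ℝ E] (h : LocallyDominated μ H) (c : ℝ) :
    LocallyDominated μ (fun t x => c • H t x) where
  aestronglyMeasurable t ht := (h.1 t ht).const_smul c
  exists_bound T := by
    obtain ⟨b, hb, hle⟩ := h.exists_bound T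
    exact ⟨fun x => ‖c‖ * b x, hb.const_mul _, fun t ht htT x =>
      (norm_smul_le _ _).trans (mul_le_mul_of_nonneg_left (hle t ht htT x) (norm_nonneg _))⟩

variable [NormedSpace ℝ E]

theorem continuousOn_integral (h : LocallyDominated μ H)
    (hc : ∀ x, ContinuousOn (fun t => H t x) (Ici 0)) :
    ContinuousOn (fun t => ∫ x, H t x ∂μ) (Ici 0) := by
  intro t₀ ht₀
  obtain ⟨b, hb, hle⟩ := h.exists_bound (t₀ + 1)
  have hev : ∀ᶠ t in nhdsWithin t₀ (Ici 0), 0 ≤ t ∧ t ≤ t₀ + 1 :=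
    (eventually_mem_nhdsWithin).and
      (nhdsWithin_le_nhds (Iic_mem_nhds (by linarith : t₀ < t₀ + 1)))
  exact continuousWithinAt_of_dominated
    (hev.mono fun t ht => h.aestronglyMeasurable t ht.1)
    (hev.mono fun t ht => ae_of_all _ fun x => hle t ht.1 ht.2 x) hb
    (ae_of_all _ fun x => hc x t₀ ht₀)

theorem hasDerivAt_integral (h : LocallyDominated μ H) (h' : LocallyDominated μ H')
    (hd : ∀ x t, HasDerivAt (fun t => H t x) (H' t x) t) {t : ℝ} (ht : 0 < t) :
    HasDerivAt (fun t => ∫ x, H t x ∂μ) (∫ x, H' t x ∂μ) t := by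
  obtain ⟨b, hb, hle⟩ := h'.exists_bound (t + t)
  have hball : ∀ τ ∈ Metric.ball t t, 0 ≤ τ ∧ τ ≤ t + t := fun τ hτ => by
    rw [Metric.mem_ball, Real.dist_eq, abs_lt] at hτ
    constructor <;> linarith
  refine (hasDerivAt_integral_of_dominated_loc_of_deriv_le (bound := b)
    (Metric.ball_mem_nhds t ht) ?_ (h.integrable ht.le) (h'.1 t ht.le) ?_ hb ?_).2
  · exact Filter.eventually_of_mem (Metric.ball_mem_nhds t ht) fun τ hτ => h.1 τ (hball τ hτ).1
  · exact ae_of_all _ fun x τ hτ => hle τ (hball τ hτ).1 (hball τ hτ).2 x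
  · exact ae_of_all _ fun x τ _ => hd x τ

theorem hasDerivWithinAt_integral (h : LocallyDominated μ H) (h' : LocallyDominated μ H')
    (hd : ∀ x t, HasDerivAt (fun t => H t x) (H' t x) t)
    (hc : ∀ x, ContinuousOn (fun t => H' t x) (Ici 0)) {t : ℝ} (ht : 0 ≤ t) :
    HasDerivWithinAt (fun t => ∫ x, H t x ∂μ) (∫ x, H' t x ∂μ) (Ici 0) t := by
  rcases ht.eq_or_lt with rfl | ht0
  · have hpos : ∀ t ∈ Ioi (0 : ℝ), HasDerivAt (fun t => ∫ x, H t x ∂μ) (∫ x, H' t x ∂μ) t :=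
      fun t ht => hasDerivAt_integral h h' hd ht
    -- Domination is available only for `t ≥ 0`, so the one-sided derivative at `0` is the limit of
    -- the derivatives at `t > 0`.
    refine hasDerivWithinAt_Ici_of_tendsto_deriv (s := Ioi 0)
      (fun t ht => (hpos t ht).differentiableAt.differentiableWithinAt) ?_ self_mem_nhdsWithin ?_
    · exact (h.continuousOn_integral (fun x t _ => (hd x t).continuousAt.continuousWithinAt) 0
        (mem_Ici.2 le_rfl)).mono Ioi_subset_Ici_self
    · have h1 : Filter.Tendsto (fun t => ∫ x, H' t x ∂μ) (nhdsWithin 0 (Ioi 0))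
          (nhds (∫ x, H' 0 x ∂μ)) :=
        ((h'.continuousOn_integral hc) 0 (mem_Ici.2 le_rfl)).mono Ioi_subset_Ici_self
      refine h1.congr' ?_
      filter_upwards [self_mem_nhdsWithin] with t ht
      exact (hpos t ht).deriv.symm
  · exact (hasDerivAt_integral h h' hd ht0).hasDerivWithinAt

end LocallyDominated

/-! ### Existence -/

/-- The `L²` function with Fourier transform `h`. -/
noncomputable def ofSpectrum (h : Rn n → ℂ) : L2 n :=
  open scoped Classical in
  if hh : MemLp h 2 volume then 𝓕⁻ (hh.toLp h) else 0

theorem fourier_ofSpectrum {h : Rn n → ℂ} (hh : MemLp h 2 volume) :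
    (𝓕 (ofSpectrum h) : L2 n) = hh.toLp h := by
  rw [ofSpectrum, dif_pos hh, fourier_fourierInv_eq]

theorem fourier_ofSpectrum_ae {h : Rn n → ℂ} (hh : MemLp h 2 volume) :
    (𝓕 (ofSpectrum h) : L2 n) =ᵐ[volume] h := by
  rw [fourier_ofSpectrum hh]
  exact hh.coeFn_toLp

theorem ofSpectrum_fourier {f : L2 n} {h : Rn n → ℂ} (hh : h = (𝓕 f : L2 n)) :
    ofSpectrum h = f := by
  subst hh
  rw [ofSpectrum, dif_pos (Lp.memLp _), Lp.toLp_coeFn, fourierInv_fourier_eq]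

theorem toDist_ofSpectrum_apply {h : Rn n → ℂ} (hh : MemLp h 2 volume) (φ : 𝓢(Rn n, ℂ)) :
    toDist (ofSpectrum h) φ = ∫ ξ, (𝓕⁻ φ) ξ * h ξ := by
  rw [toDist_apply_eq_integral_fourierInv]
  refine integral_congr_ae ?_
  filter_upwards [fourier_ofSpectrum_ae hh] with ξ hξ
  rw [hξ]

/-- The superposition of the modes with data `f`, `g`; `p` selects a component of `(u, v, z)`. -/
noncomputable def modeSpectrum (γ : ℝ) (p : (ℝ × ℝ × ℝ) →L[ℝ] ℝ) (f g : Rn n → ℂ) (t : ℝ)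
    (ξ : Rn n) : ℂ :=
  (p (modeFlow γ (1, 0, 0) t (laplaceSymbol ξ)) : ℂ) * f ξ
    + (p (modeFlow γ (0, 1, 0) t (laplaceSymbol ξ)) : ℂ) * g ξ

namespace ModeComponent

/-- The component `u`. -/
def u : (ℝ × ℝ × ℝ) →L[ℝ] ℝ := ContinuousLinearMap.fst ℝ ℝ (ℝ × ℝ)

/-- The component `v = u'`. -/
noncomputable def v : (ℝ × ℝ × ℝ) →L[ℝ] ℝ :=
  (ContinuousLinearMap.fst ℝ ℝ ℝ).comp (ContinuousLinearMap.snd ℝ ℝ (ℝ × ℝ))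

/-- The component `z = g ∗ u`. -/
noncomputable def z : (ℝ × ℝ × ℝ) →L[ℝ] ℝ :=
  (ContinuousLinearMap.snd ℝ ℝ ℝ).comp (ContinuousLinearMap.snd ℝ ℝ (ℝ × ℝ))

@[simp] theorem u_apply (x : ℝ × ℝ × ℝ) : u x = x.1 := rfl
@[simp] theorem v_apply (x : ℝ × ℝ × ℝ) : v x = x.2.1 := rfl
@[simp] theorem z_apply (x : ℝ × ℝ × ℝ) : z x = x.2.2 := rfl

end ModeComponent

open ModeComponent

variable {γ : ℝ} {f g : Rn n → ℂ}

theorem hasDerivAt_spectrum_u (ξ : Rn n) (t : ℝ) :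
    HasDerivAt (fun t => modeSpectrum γ u f g t ξ) (modeSpectrum γ v f g t ξ) t := by
  have h0 := ((isMode_modeFlow γ (laplaceSymbol ξ) (1, 0, 0)).hasDerivAt_u t).ofReal_comp
  have h1 := ((isMode_modeFlow γ (laplaceSymbol ξ) (0, 1, 0)).hasDerivAt_u t).ofReal_comp
  exact (h0.mul_const (f ξ)).add (h1.mul_const (g ξ))

theorem hasDerivAt_spectrum_v (ξ : Rn n) (t : ℝ) :
    HasDerivAt (fun t => modeSpectrum γ v f g t ξ)
      (-(laplaceSymbol ξ : ℂ) *
        (modeSpectrum γ u f g t ξ + modeSpectrum γ v f g t ξ - modeSpectrum γ z f g t ξ)) t := by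
  have h0 := ((isMode_modeFlow γ (laplaceSymbol ξ) (1, 0, 0)).hasDerivAt_v t).ofReal_comp
  have h1 := ((isMode_modeFlow γ (laplaceSymbol ξ) (0, 1, 0)).hasDerivAt_v t).ofReal_comp
  refine ((h0.mul_const (f ξ)).add (h1.mul_const (g ξ))).congr_deriv ?_
  simp only [modeSpectrum, u_apply, v_apply, z_apply]
  push_cast
  ring

theorem hasDerivAt_spectrum_z (ξ : Rn n) (t : ℝ) :
    HasDerivAt (fun t => modeSpectrum γ z f g t ξ)
      (modeSpectrum γ u f g t ξ - γ * modeSpectrum γ z f g t ξ) t := by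
  have h0 := ((isMode_modeFlow γ (laplaceSymbol ξ) (1, 0, 0)).hasDerivAt_z t).ofReal_comp
  have h1 := ((isMode_modeFlow γ (laplaceSymbol ξ) (0, 1, 0)).hasDerivAt_z t).ofReal_comp
  refine ((h0.mul_const (f ξ)).add (h1.mul_const (g ξ))).congr_deriv ?_
  simp only [modeSpectrum, u_apply, z_apply]
  push_cast
  ring

theorem continuous_spectrum (p : (ℝ × ℝ × ℝ) →L[ℝ] ℝ) (ξ : Rn n) :
    Continuous fun t => modeSpectrum γ p f g t ξ := by
  have h : ∀ x, Continuous fun t => (p (modeFlow γ x t (laplaceSymbol ξ)) : ℂ) := fun x =>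
    Complex.continuous_ofReal.comp (p.continuous.comp
      ((continuous_modeFlow γ x).comp (Continuous.prodMk_left _)))
  exact ((h _).mul continuous_const).add ((h _).mul continuous_const)

theorem aestronglyMeasurable_spectrum (p : (ℝ × ℝ × ℝ) →L[ℝ] ℝ) (t : ℝ)
    (hf : AEStronglyMeasurable f volume) (hg : AEStronglyMeasurable g volume) :
    AEStronglyMeasurable (modeSpectrum γ p f g t) volume := by
  have h : ∀ x, Continuous fun ξ : Rn n => (p (modeFlow γ x t (laplaceSymbol ξ)) : ℂ) := fun x =>
    Complex.continuous_ofReal.comp (p.continuous.comp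
      ((continuous_modeFlow γ x).comp (continuous_const.prodMk continuous_laplaceSymbol)))
  exact ((h _).aestronglyMeasurable.mul hf).add ((h _).aestronglyMeasurable.mul hg)

theorem norm_spectrum_le_of_le {p : (ℝ × ℝ × ℝ) →L[ℝ] ℝ} {t B : ℝ} {ξ : Rn n}
    (h0 : |p (modeFlow γ (1, 0, 0) t (laplaceSymbol ξ))| ≤ B)
    (h1 : |p (modeFlow γ (0, 1, 0) t (laplaceSymbol ξ))| ≤ B) :
    ‖modeSpectrum γ p f g t ξ‖ ≤ B * (‖f ξ‖ + ‖g ξ‖) := by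
  refine (norm_add_le _ _).trans ?_
  rw [norm_mul, norm_mul, Complex.norm_real, Complex.norm_real, mul_add, Real.norm_eq_abs,
    Real.norm_eq_abs]
  gcongr

theorem norm_spectrum_le (hγ : 1 < γ) {t T : ℝ} (ht : 0 ≤ t) (htT : t ≤ T) (ξ : Rn n) :
    ‖modeSpectrum γ u f g t ξ‖ ≤ 3 * Real.exp (3 * T) * (‖f ξ‖ + ‖g ξ‖) ∧
    ‖modeSpectrum γ v f g t ξ‖ ≤
      3 * Real.exp (3 * T) * (1 + laplaceSymbol ξ) * (‖f ξ‖ + ‖g ξ‖) ∧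
    ‖modeSpectrum γ z f g t ξ‖ ≤ 3 * Real.exp (3 * T) * (‖f ξ‖ + ‖g ξ‖) := by
  obtain ⟨a1, a2, a3⟩ := (isMode_modeFlow γ (laplaceSymbol ξ) (1, 0, 0)).abs_le_of_le hγ
    (laplaceSymbol_nonneg ξ) (by simp [modeFlow_zero]) (by simp [modeFlow_zero]) ht htT
  obtain ⟨b1, b2, b3⟩ := (isMode_modeFlow γ (laplaceSymbol ξ) (0, 1, 0)).abs_le_of_le hγ
    (laplaceSymbol_nonneg ξ) (by simp [modeFlow_zero]) (by simp [modeFlow_zero]) ht htT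
  exact ⟨norm_spectrum_le_of_le a1 b1, norm_spectrum_le_of_le a2 b2, norm_spectrum_le_of_le a3 b3⟩

theorem memLp_of_norm_le {h : Rn n → ℂ} {B : ℝ} (hf : MemLp f 2 volume) (hg : MemLp g 2 volume)
    (hm : AEStronglyMeasurable h volume) (hle : ∀ ξ, ‖h ξ‖ ≤ B * (‖f ξ‖ + ‖g ξ‖)) :
    MemLp h 2 volume :=
  ((hf.norm.add hg.norm).const_mul B).of_le hm
    (ae_of_all _ fun ξ => (hle ξ).trans (le_abs_self _))

theorem memLp_modeSpectrum_u (hγ : 1 < γ) (hf : MemLp f 2 volume) (hg : MemLp g 2 volume)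
    {t : ℝ} (ht : 0 ≤ t) : MemLp (modeSpectrum γ u f g t) 2 volume :=
  memLp_of_norm_le hf hg (aestronglyMeasurable_spectrum u t hf.1 hg.1)
    fun ξ => (norm_spectrum_le hγ ht le_rfl ξ).1

theorem memLp_modeSpectrum_z (hγ : 1 < γ) (hf : MemLp f 2 volume) (hg : MemLp g 2 volume)
    {t : ℝ} (ht : 0 ≤ t) : MemLp (modeSpectrum γ z f g t) 2 volume :=
  memLp_of_norm_le hf hg (aestronglyMeasurable_spectrum z t hf.1 hg.1)
    fun ξ => (norm_spectrum_le hγ ht le_rfl ξ).2.2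

/-- The velocity bound grows like `1 + |ξ|²`, so it is `(1 - Δ)⁻¹ u_t` that is shown to lie in `L²`.
-/
theorem memLp_modeSpectrum_v (hγ : 1 < γ) (hf : MemLp f 2 volume) (hg : MemLp g 2 volume)
    {t : ℝ} (ht : 0 ≤ t) :
    MemLp (fun ξ => ((1 + laplaceSymbol ξ : ℝ) : ℂ)⁻¹ * modeSpectrum γ v f g t ξ) 2 volume := by
  have h1 : ∀ ξ : Rn n, 0 < 1 + laplaceSymbol ξ := fun ξ => by
    have := laplaceSymbol_nonneg ξ
    positivity
  refine memLp_of_norm_le (B := 3 * Real.exp (3 * t)) hf hg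
    (AEStronglyMeasurable.mul (Continuous.aestronglyMeasurable ?_)
      (aestronglyMeasurable_spectrum v t hf.1 hg.1)) fun ξ => ?_
  · exact (Complex.continuous_ofReal.comp (by fun_prop)).inv₀
      fun ξ => Complex.ofReal_ne_zero.2 (h1 ξ).ne'
  · rw [norm_mul, norm_inv, Complex.norm_real, Real.norm_of_nonneg (h1 ξ).le,
      inv_mul_le_iff₀ (h1 ξ)]
    refine ((norm_spectrum_le hγ ht le_rfl ξ).2.1).trans (le_of_eq (by ring))

theorem fourierInv_sub_laplacian_apply (φ : 𝓢(Rn n, ℂ)) (ξ : Rn n) :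
    (𝓕⁻ (φ - Δ φ)) ξ = ((1 + laplaceSymbol ξ : ℝ) : ℂ) * (𝓕⁻ φ) ξ := by
  have h : 𝓕⁻ (φ - Δ φ) = 𝓕⁻ φ - 𝓕⁻ (Δ φ) := map_sub (fourierInvCLM ℂ 𝓢(Rn n, ℂ)) _ _
  rw [h, sub_apply, fourierInv_laplacian_apply]
  push_cast
  ring

/-- The growth `1 + |ξ|²` of the modes is moved to the test function: it turns `𝓕⁻ φ` into `𝓕⁻ (φ -
Δ φ)`, again Schwartz, whose product with the `L²` data is integrable. -/
theorem locallyDominated_modeSpectrum (hγ : 1 < γ) (hf : MemLp f 2 volume)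
    (hg : MemLp g 2 volume) (φ : 𝓢(Rn n, ℂ)) :
    LocallyDominated volume (fun t ξ => (𝓕⁻ φ) ξ * modeSpectrum γ u f g t ξ) ∧
    LocallyDominated volume (fun t ξ => (𝓕⁻ φ) ξ * modeSpectrum γ v f g t ξ) ∧
    LocallyDominated volume (fun t ξ => (𝓕⁻ φ) ξ * modeSpectrum γ z f g t ξ) := by
  have hm : ∀ (p : (ℝ × ℝ × ℝ) →L[ℝ] ℝ) (t : ℝ),
      AEStronglyMeasurable (fun ξ => (𝓕⁻ φ) ξ * modeSpectrum γ p f g t ξ) volume := fun p t =>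
    (SchwartzMap.continuous _).aestronglyMeasurable.mul
      (aestronglyMeasurable_spectrum p t hf.1 hg.1)
  have hb : ∀ T : ℝ, Integrable
      (fun ξ => 3 * Real.exp (3 * T) * (‖(𝓕⁻ (φ - Δ φ)) ξ‖ * (‖f ξ‖ + ‖g ξ‖))) volume := fun T =>
    ((((𝓕⁻ (φ - Δ φ)).memLp 2 volume).norm).integrable_mul (hf.norm.add hg.norm)).const_mul _
  have hφ : ∀ ξ, ‖(𝓕⁻ (φ - Δ φ)) ξ‖ = (1 + laplaceSymbol ξ) * ‖(𝓕⁻ φ) ξ‖ := fun ξ => by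
    have := laplaceSymbol_nonneg ξ
    rw [fourierInv_sub_laplacian_apply, norm_mul, Complex.norm_real,
      Real.norm_of_nonneg (by positivity)]
  have hle : ∀ (p : (ℝ × ℝ × ℝ) →L[ℝ] ℝ) (t T : ℝ) (ξ : Rn n),
      ‖modeSpectrum γ p f g t ξ‖ ≤
        3 * Real.exp (3 * T) * (1 + laplaceSymbol ξ) * (‖f ξ‖ + ‖g ξ‖) →
      ‖(𝓕⁻ φ) ξ * modeSpectrum γ p f g t ξ‖ ≤
        3 * Real.exp (3 * T) * (‖(𝓕⁻ (φ - Δ φ)) ξ‖ * (‖f ξ‖ + ‖g ξ‖)) := fun p t T ξ h => by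
    rw [norm_mul, hφ]
    exact (mul_le_mul_of_nonneg_left h (norm_nonneg _)).trans (le_of_eq (by ring))
  have hone : ∀ (T : ℝ) (ξ : Rn n), 3 * Real.exp (3 * T) * (‖f ξ‖ + ‖g ξ‖) ≤
      3 * Real.exp (3 * T) * (1 + laplaceSymbol ξ) * (‖f ξ‖ + ‖g ξ‖) := fun T ξ => by
    have := laplaceSymbol_nonneg ξ
    refine mul_le_mul_of_nonneg_right ?_ (by positivity)
    exact le_mul_of_one_le_right (by positivity) (by linarith)
  exact ⟨⟨fun t _ => hm u t, fun T => ⟨_, hb T, fun t ht htT ξ => hle u t T ξ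
      ((norm_spectrum_le hγ ht htT ξ).1.trans (hone T ξ))⟩⟩,
    ⟨fun t _ => hm v t, fun T => ⟨_, hb T, fun t ht htT ξ => hle v t T ξ
      (norm_spectrum_le hγ ht htT ξ).2.1⟩⟩,
    ⟨fun t _ => hm z t, fun T => ⟨_, hb T, fun t ht htT ξ => hle z t T ξ
      ((norm_spectrum_le hγ ht htT ξ).2.2.trans (hone T ξ))⟩⟩⟩

/-- By Plancherel the distance is an `L²` integral over frequencies, and dominated convergence
applies. -/
theorem continuousOn_ofSpectrum_modeSpectrum (hγ : 1 < γ) (hf : MemLp f 2 volume)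
    (hg : MemLp g 2 volume) :
    ContinuousOn (fun t => ofSpectrum (modeSpectrum γ u f g t)) (Ici 0) := by
  intro t₀ ht₀
  have ht₀' : 0 ≤ t₀ := ht₀
  have hmem := fun t (ht : (0:ℝ) ≤ t) => memLp_modeSpectrum_u hγ hf hg ht
  have hD : LocallyDominated volume
      (fun t ξ => ‖modeSpectrum γ u f g t ξ - modeSpectrum γ u f g t₀ ξ‖ ^ 2) := by
    refine ⟨fun t ht => (((hmem t ht).sub (hmem t₀ ht₀)).1.norm.pow 2), fun T => ?_⟩
    refine ⟨fun ξ => (2 * (3 * Real.exp (3 * max T t₀) * (‖f ξ‖ + ‖g ξ‖))) ^ 2, ?_, ?_⟩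
    · exact (((hf.norm.add hg.norm).const_mul _).const_mul _).integrable_sq
    · intro t ht htT ξ
      rw [norm_pow, norm_norm]
      refine pow_le_pow_left₀ (norm_nonneg _) ((norm_sub_le _ _).trans ?_) 2
      have h1 := (norm_spectrum_le (f := f) (g := g) hγ ht (htT.trans (le_max_left T t₀)) ξ).1
      have h2 := (norm_spectrum_le (f := f) (g := g) hγ ht₀' (le_max_right T t₀) ξ).1
      linarith
  have hcont := hD.continuousOn_integral (fun ξ => Continuous.continuousOn
    (((continuous_spectrum u ξ).sub continuous_const).norm.pow 2)) t₀ ht₀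
  have hnorm : ∀ t, 0 ≤ t →
      ‖ofSpectrum (modeSpectrum γ u f g t) - ofSpectrum (modeSpectrum γ u f g t₀)‖ =
      √(∫ ξ, ‖modeSpectrum γ u f g t ξ - modeSpectrum γ u f g t₀ ξ‖ ^ 2) := fun t ht => by
    have h1 : (𝓕 (ofSpectrum (modeSpectrum γ u f g t)
        - ofSpectrum (modeSpectrum γ u f g t₀)) : L2 n)
        = ((hmem t ht).sub (hmem t₀ ht₀)).toLp _ := by
      have h2 := map_sub (fourierCLM ℂ (L2 n)) (ofSpectrum (modeSpectrum γ u f g t))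
        (ofSpectrum (modeSpectrum γ u f g t₀))
      simp only [fourierCLM_apply] at h2
      rw [h2, fourier_ofSpectrum (hmem t ht),
        fourier_ofSpectrum (hmem t₀ ht₀), ← MemLp.toLp_sub]
    rw [← Lp.norm_fourier_eq, h1, Lp.norm_toLp,
      ((hmem t ht).sub (hmem t₀ ht₀)).eLpNorm_eq_integral_rpow_norm (by norm_num) (by norm_num),
      ENNReal.toReal_ofReal (by positivity), Real.sqrt_eq_rpow]
    norm_num
  have h0 : ∫ ξ, ‖modeSpectrum γ u f g t₀ ξ - modeSpectrum γ u f g t₀ ξ‖ ^ 2 = 0 := by simp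
  rw [ContinuousWithinAt, tendsto_iff_norm_sub_tendsto_zero]
  have h2 := hcont.sqrt
  rw [ContinuousWithinAt, h0, Real.sqrt_zero] at h2
  refine h2.congr' ?_
  filter_upwards [self_mem_nhdsWithin] with t ht
  exact (hnorm t ht).symm

/-- The memory term of a solution is the mode component `z`. -/
theorem integral_relaxation_mul_eq {U Z : ℝ → ℂ} (hU : ContinuousOn U (Ici 0))
    (hZ : ∀ t, 0 ≤ t → HasDerivWithinAt Z (U t - γ * Z t) (Ici 0) t) (hZ0 : Z 0 = 0) {t : ℝ}
    (ht : 0 ≤ t) : ∫ η in (0:ℝ)..t, (relaxation γ (t - η) : ℂ) * U η = Z t := by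
  have hR : ∀ η, HasDerivAt (fun η => (relaxation γ (t - η) : ℂ))
      (γ * (relaxation γ (t - η) : ℂ)) η := fun η => by
    have h := (((((hasDerivAt_id η).const_sub t).const_mul (-γ)).exp).ofReal_comp)
    refine h.congr_deriv ?_
    simp only [relaxation, id_eq]
    push_cast
    ring
  have hd : ∀ η, 0 ≤ η → HasDerivWithinAt (fun η => (relaxation γ (t - η) : ℂ) * Z η)
      ((relaxation γ (t - η) : ℂ) * U η) (Ici 0) η := fun η hη => by
    refine ((hR η).hasDerivWithinAt.mul (hZ η hη)).congr_deriv ?_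
    ring
  have hint : IntervalIntegrable (fun η => (relaxation γ (t - η) : ℂ) * U η) volume 0 t := by
    refine ContinuousOn.intervalIntegrable ?_
    rw [uIcc_of_le ht]
    refine ContinuousOn.mul (fun η _ => (hR η).continuousAt.continuousWithinAt)
      (hU.mono Icc_subset_Ici_self)
  rw [intervalIntegral.integral_eq_sub_of_hasDeriv_right_of_le ht
    (fun η hη => ((hd η hη.1).continuousWithinAt).mono Icc_subset_Ici_self)
    (fun η hη => (hd η hη.1.le).mono fun x hx => hη.1.le.trans (le_of_lt hx)) hint, hZ0]
  simp [relaxation]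

theorem isSolution_ofSpectrum (hγ : 1 < γ) (u₀ u₁ : L2 n) :
    IsSolution γ u₀ u₁ (fun t => ofSpectrum (modeSpectrum γ u
      ((𝓕 u₀ : L2 n) : Rn n → ℂ) ((𝓕 u₁ : L2 n) : Rn n → ℂ) t)) := by
  set f : Rn n → ℂ := ((𝓕 u₀ : L2 n) : Rn n → ℂ) with hfdef
  set g : Rn n → ℂ := ((𝓕 u₁ : L2 n) : Rn n → ℂ) with hgdef
  have hf : MemLp f 2 volume := Lp.memLp _
  have hg : MemLp g 2 volume := Lp.memLp _
  set U : ℝ → L2 n := fun t => ofSpectrum (modeSpectrum γ u f g t) with hUdef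
  set Z : ℝ → L2 n := fun t => ofSpectrum (modeSpectrum γ z f g t) with hZdef
  set Y : ℝ → L2 n := fun t => ofSpectrum
    (fun ξ => ((1 + laplaceSymbol ξ : ℝ) : ℂ)⁻¹ * modeSpectrum γ v f g t ξ) with hYdef
  have hU : ∀ (φ : 𝓢(Rn n, ℂ)) t, 0 ≤ t →
      toDist (U t) φ = ∫ ξ, (𝓕⁻ φ) ξ * modeSpectrum γ u f g t ξ := fun φ t ht =>
    toDist_ofSpectrum_apply (memLp_modeSpectrum_u hγ hf hg ht) φ
  have hZ : ∀ (φ : 𝓢(Rn n, ℂ)) t, 0 ≤ t →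
      toDist (Z t) φ = ∫ ξ, (𝓕⁻ φ) ξ * modeSpectrum γ z f g t ξ := fun φ t ht =>
    toDist_ofSpectrum_apply (memLp_modeSpectrum_z hγ hf hg ht) φ
  -- `u_t` is realised as `(1 - Δ) Y` with `Y` in `L²`, which makes it a tempered distribution; `W`
  -- below is read off from the equation.
  let V : ℝ → 𝓢'(Rn n, ℂ) := fun t => toDist (Y t) - Δ (toDist (Y t))
  have hV : ∀ (φ : 𝓢(Rn n, ℂ)) t, 0 ≤ t →
      V t φ = ∫ ξ, (𝓕⁻ φ) ξ * modeSpectrum γ v f g t ξ := fun φ t ht => by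
    have h1 : V t φ = toDist (Y t) (φ - Δ φ) := by
      rw [map_sub]
      simp only [V, sub_apply, TemperedDistribution.laplacian_apply_apply]
    rw [h1, hYdef, toDist_ofSpectrum_apply (memLp_modeSpectrum_v hγ hf hg ht)]
    congr 1
    ext ξ
    have h2 : ((1 + laplaceSymbol ξ : ℝ) : ℂ) ≠ 0 := by
      have := laplaceSymbol_nonneg ξ
      exact Complex.ofReal_ne_zero.2 (by positivity)
    rw [fourierInv_sub_laplacian_apply]
    field_simp
  let W : ℝ → 𝓢'(Rn n, ℂ) := fun t => Δ (toDist (U t)) + Δ (V t) - Δ (toDist (Z t))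
  have hW : ∀ (φ : 𝓢(Rn n, ℂ)) t, W t φ = toDist (U t) (Δ φ) + V t (Δ φ) - toDist (Z t) (Δ φ) :=
    fun φ t => by
      simp only [W, sub_apply, add_apply, TemperedDistribution.laplacian_apply_apply]
  have hdom := locallyDominated_modeSpectrum hγ hf hg
  have hcont : ∀ (φ : 𝓢(Rn n, ℂ)) (p : (ℝ × ℝ × ℝ) →L[ℝ] ℝ) (ξ : Rn n),
      ContinuousOn (fun t => (𝓕⁻ φ) ξ * modeSpectrum γ p f g t ξ) (Ici 0) := fun φ p ξ =>
    (continuous_const.mul (continuous_spectrum p ξ)).continuousOn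
  refine ⟨continuousOn_ofSpectrum_modeSpectrum hγ hf hg, ?_, V, W, ?_, fun φ => ⟨?_, ?_, ?_, ?_⟩⟩
  · exact ofSpectrum_fourier (by ext ξ; simp [modeSpectrum, modeFlow_zero, hfdef])
  · ext φ
    rw [hV φ 0 le_rfl, toDist_apply_eq_integral_fourierInv]
    simp [modeSpectrum, modeFlow_zero, hgdef]
  · intro t ht
    rw [hV φ t ht]
    exact ((hdom φ).1.hasDerivWithinAt_integral (hdom φ).2.1
      (fun ξ τ => (hasDerivAt_spectrum_u ξ τ).const_mul _) (hcont φ v) ht).congr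
      (fun τ hτ => hU φ τ hτ) (hU φ t ht)
  · exact ((hdom φ).2.1.continuousOn_integral (hcont φ v)).congr fun τ hτ => hV φ τ hτ
  · intro t ht
    have h1 := (((hdom (Δ φ)).1.add (hdom (Δ φ)).2.1).sub (hdom (Δ φ)).2.2)
    have h2 := (hdom φ).2.1.hasDerivAt_integral h1 (fun ξ τ => by
      refine ((hasDerivAt_spectrum_v ξ τ).const_mul ((𝓕⁻ φ) ξ)).congr_deriv ?_
      rw [fourierInv_laplacian_apply]
      ring) ht
    rw [hW, hU _ t ht.le, hV _ t ht.le, hZ _ t ht.le,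
      ← integral_add ((hdom _).1.integrable ht.le) ((hdom _).2.1.integrable ht.le),
      ← integral_sub (((hdom _).1.add (hdom _).2.1).integrable ht.le)
        ((hdom _).2.2.integrable ht.le)]
    refine h2.congr_of_eventuallyEq ?_
    filter_upwards [Ioi_mem_nhds ht] with τ hτ
    exact hV φ τ (le_of_lt hτ)
  · intro t ht
    have hUd : ∀ τ, 0 ≤ τ → HasDerivWithinAt (fun τ => toDist (Z τ) (Δ φ))
        (toDist (U τ) (Δ φ) - γ * toDist (Z τ) (Δ φ)) (Ici 0) τ := fun τ hτ => by
      have h1 := (hdom (Δ φ)).1.sub ((hdom (Δ φ)).2.2.const_smul γ)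
      have h2 := (hdom (Δ φ)).2.2.hasDerivWithinAt_integral h1 (fun ξ τ => by
        refine ((hasDerivAt_spectrum_z ξ τ).const_mul ((𝓕⁻ (Δ φ)) ξ)).congr_deriv ?_
        rw [Complex.real_smul]
        ring) (fun ξ => (hcont _ u ξ).sub ((hcont _ z ξ).const_smul γ)) hτ
      rw [integral_sub ((hdom _).1.integrable hτ) (((hdom _).2.2.const_smul γ).integrable hτ),
        integral_smul, Complex.real_smul, ← hU _ τ hτ, ← hZ _ τ hτ] at h2
      exact h2.congr (fun τ hτ => hZ _ τ hτ) (hZ _ τ hτ)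
    have hUc : ContinuousOn (fun τ => toDist (U τ) (Δ φ)) (Ici 0) :=
      ((hdom (Δ φ)).1.continuousOn_integral (hcont _ u)).congr fun τ hτ => hU _ τ hτ
    have hZ0 : toDist (Z 0) (Δ φ) = 0 := by
      rw [hZ _ 0 le_rfl]
      simp [modeSpectrum, modeFlow_zero]
    have h3 := integral_relaxation_mul_eq hUc hUd hZ0 ht.le
    have h4 : ∀ T : 𝓢'(Rn n, ℂ), (Δ T) φ = T (Δ φ) := fun T =>
      TemperedDistribution.laplacian_apply_apply T φ
    simp only [h4, hW]
    rw [h3]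
    ring

/-! ### Uniqueness -/

/-- The mean value inequality on `[ε, t]` with `ε → 0`: a solution has a second time derivative only
for `t > 0`. -/
theorem norm_sub_le_of_hasDerivAt_Ioc {Q Q' : ℝ → ℂ} {t C : ℝ} (ht : 0 < t)
    (hc : ContinuousOn Q (Icc 0 t)) (hd : ∀ τ ∈ Ioc 0 t, HasDerivAt Q (Q' τ) τ) (hC : 0 ≤ C)
    (hb : ∀ τ ∈ Ioc 0 t, ‖Q' τ‖ ≤ C) : ‖Q t - Q 0‖ ≤ C * t := by
  have hlim : Filter.Tendsto (fun ε => ‖Q t - Q ε‖) (nhdsWithin 0 (Ioc 0 t))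
      (nhds ‖Q t - Q 0‖) :=
    ((tendsto_const_nhds.sub (((hc 0 ⟨le_rfl, ht.le⟩).mono Ioc_subset_Icc_self))).norm)
  have : (nhdsWithin (0:ℝ) (Ioc 0 t)).NeBot := by
    rw [nhdsWithin_Ioc_eq_nhdsGT ht]
    infer_instance
  refine le_of_tendsto hlim ?_
  filter_upwards [self_mem_nhdsWithin] with ε hε
  have h := norm_image_sub_le_of_norm_deriv_le_segment' (f := Q) (f' := Q') (a := ε) (b := t)
    (fun τ hτ => (hd τ ⟨hε.1.trans_le hτ.1, hτ.2⟩).hasDerivWithinAt)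
    (fun τ hτ => hb τ ⟨hε.1.trans_le hτ.1, hτ.2.le⟩) t ⟨hε.2, le_rfl⟩
  exact h.trans (mul_le_mul_of_nonneg_left (by linarith [hε.1]) hC)

/-- A family of scalar functions `F φ` with `F'' = F ∘ A + F' ∘ A - g ∗ (F ∘ A)`, zero initial
data and an operator `A` that is bounded with respect to a gauge `N` vanishes. -/
theorem eq_zero_of_bounded_hierarchy {X : Type*} {S : Set X} {A : X → X} {N : X → ℝ} {K M γ T : ℝ}
    (hγ : 0 ≤ γ) (hK : 0 ≤ K) (hM : 0 ≤ M) (hT : 0 ≤ T) (hS : ∀ φ ∈ S, A φ ∈ S)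
    (hN : ∀ φ ∈ S, N (A φ) ≤ K * N φ) (hN0 : ∀ φ, 0 ≤ N φ)
    {F G : X → ℝ → ℂ} (hF : ∀ φ t, 0 ≤ t → HasDerivWithinAt (F φ) (G φ t) (Ici 0) t)
    (hGc : ∀ φ, ContinuousOn (G φ) (Ici 0))
    (hG : ∀ φ t, 0 < t → HasDerivAt (G φ) (F (A φ) t + G (A φ) t
      - ∫ η in (0:ℝ)..t, (relaxation γ (t - η) : ℂ) * F (A φ) η) t)
    (hF0 : ∀ φ, F φ 0 = 0) (hG0 : ∀ φ, G φ 0 = 0)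
    (hbound : ∀ φ ∈ S, ∀ t ∈ Icc 0 T, ‖F φ t‖ ≤ M * N φ) :
    ∀ φ ∈ S, ∀ t ∈ Icc 0 T, F φ t = 0 := by
  set L := K * (1 + (1 + T) * T) with hL
  have hL0 : 0 ≤ L := by positivity
  have hFc : ∀ φ, ContinuousOn (F φ) (Ici 0) := fun φ t ht => (hF φ t ht).continuousWithinAt
  -- Picard iteration: each round passes from `φ` to `A φ`, costing `K`, and integrates in time,
  -- gaining `t / (k + 1)`. The bound must hold for all of `S` at once.
  have key : ∀ k : ℕ, ∀ φ ∈ S, ∀ t ∈ Icc 0 T, ‖F φ t‖ ≤ M * N φ * ((L * t) ^ k / k.factorial) := by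
    intro k
    induction k with
    | zero => simpa using hbound
    | succ k ih =>
      intro φ hφ
      have hnonneg : ∀ t, 0 ≤ t → 0 ≤ M * N φ * ((L * t) ^ k / k.factorial) := fun t ht => by
        have := hN0 φ
        positivity
      have hGle : ∀ t ∈ Icc 0 T, ‖G φ t‖ ≤ L * (M * N φ * ((L * t) ^ k / k.factorial)) := by
        intro t ht
        rcases ht.1.eq_or_lt with rfl | ht0
        · rw [hG0, norm_zero]
          exact mul_nonneg hL0 (hnonneg 0 le_rfl)
        set B := K * (M * N φ * ((L * t) ^ k / k.factorial)) with hB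
        have hB0 : 0 ≤ B := mul_nonneg hK (hnonneg t ht.1)
        have hFB : ∀ τ ∈ Icc 0 t, ‖F (A φ) τ‖ ≤ B := fun τ hτ => by
          refine (ih (A φ) (hS φ hφ) τ ⟨hτ.1, hτ.2.trans ht.2⟩).trans ?_
          have h1 : (L * τ) ^ k / k.factorial ≤ (L * t) ^ k / k.factorial := by
            have := mul_nonneg hL0 hτ.1
            have := hτ.2
            gcongr
          have h2 : 0 ≤ (L * τ) ^ k / k.factorial := by
            have := mul_nonneg hL0 hτ.1
            positivity
          have h3 := hN φ hφ
          have h4 := hN0 φ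
          calc M * N (A φ) * ((L * τ) ^ k / k.factorial)
              ≤ M * (K * N φ) * ((L * t) ^ k / k.factorial) := by gcongr
            _ = B := by rw [hB]; ring
        -- The induction does not bound the damping term `G (A φ)`. It is the derivative of `F (A
        -- φ)`, so subtracting that removes it and leaves only values of `F (A φ)`.
        have hQ := norm_sub_le_of_hasDerivAt_Ioc (Q := fun τ => G φ τ - F (A φ) τ)
          (Q' := fun τ => F (A φ) τ - ∫ η in (0:ℝ)..τ, (relaxation γ (τ - η) : ℂ) * F (A φ) η)
          (C := B * (1 + T)) ht0
          (((hGc φ).sub (hFc (A φ))).mono Icc_subset_Ici_self) (fun τ hτ => by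
            refine ((hG φ τ hτ.1).sub ((hF (A φ) τ hτ.1.le).hasDerivAt
              (Ici_mem_nhds hτ.1))).congr_deriv ?_
            ring) (by positivity) (fun τ hτ => by
            have h1 : ‖∫ η in (0:ℝ)..τ, (relaxation γ (τ - η) : ℂ) * F (A φ) η‖ ≤ B * |τ - 0| := by
              refine intervalIntegral.norm_integral_le_of_norm_le_const fun η hη => ?_
              rw [uIoc_of_le hτ.1.le] at hη
              rw [norm_mul, Complex.norm_real, relaxation, Real.norm_of_nonneg (Real.exp_pos _).le]
              have h2 : Real.exp (-γ * (τ - η)) ≤ 1 :=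
                Real.exp_le_one_iff.2 (by nlinarith [mul_nonneg hγ (sub_nonneg.2 hη.2)])
              have h3 := hFB η ⟨hη.1.le, hη.2.trans hτ.2⟩
              nlinarith [norm_nonneg (F (A φ) η), Real.exp_pos (-γ * (τ - η))]
            rw [sub_zero, abs_of_pos hτ.1] at h1
            have h2 := hFB τ ⟨hτ.1.le, hτ.2⟩
            have h3 : B * τ ≤ B * T := mul_le_mul_of_nonneg_left (hτ.2.trans ht.2) hB0
            exact (norm_sub_le _ _).trans (by linarith))
        simp only [hG0, hF0, sub_zero] at hQ
        have h1 := hFB t ⟨ht.1, le_rfl⟩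
        have h2 : B * (1 + T) * t ≤ B * (1 + T) * T :=
          mul_le_mul_of_nonneg_left ht.2 (by positivity)
        calc ‖G φ t‖ = ‖(G φ t - F (A φ) t) + F (A φ) t‖ := by rw [sub_add_cancel]
          _ ≤ B * (1 + T) * T + B := (norm_add_le _ _).trans (by linarith)
          _ = L * (M * N φ * ((L * t) ^ k / k.factorial)) := by rw [hB, hL]; ring
      intro t ht
      refine image_norm_le_of_norm_deriv_right_le_deriv_boundary (f := F φ) (f' := G φ)
        (B := fun t => M * N φ * ((L * t) ^ (k + 1) / (k + 1).factorial))
        (B' := fun t => L * (M * N φ * ((L * t) ^ k / k.factorial)))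
        ((hFc φ).mono Icc_subset_Ici_self)
        (fun τ hτ => (hF φ τ hτ.1).mono (Ici_subset_Ici.2 hτ.1)) ?_ (fun τ => ?_)
        (fun τ hτ => hGle τ ⟨hτ.1, hτ.2.le⟩) ht
      · simp [hF0]
      · have h := ((((hasDerivAt_id τ).const_mul L).pow (k + 1)).div_const
          ((k + 1).factorial : ℝ)).const_mul (M * N φ)
        refine h.congr_deriv ?_
        have : (k.factorial : ℝ) ≠ 0 := by positivity
        rw [Nat.factorial_succ]
        push_cast
        simp only [id_eq]
        field_simp
  intro φ hφ t ht
  have hlim : Filter.Tendsto (fun k : ℕ => M * N φ * ((L * t) ^ k / k.factorial)) Filter.atTop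
      (nhds 0) := by
    simpa using (FloorSemiring.tendsto_pow_div_factorial_atTop (L * t)).const_mul (M * N φ)
  exact norm_le_zero_iff.1 (ge_of_tendsto' hlim fun k => key k φ hφ t ht)

theorem norm_toDist_apply_le (f : L2 n) (φ : 𝓢(Rn n, ℂ)) :
    ‖toDist f φ‖ ≤ ‖f‖ * ‖(𝓕⁻ φ).toLp 2 volume‖ := by
  rw [toDist_apply_eq_integral_fourierInv]
  have hm : MemLp (𝓕⁻ φ : 𝓢(Rn n, ℂ)) (ENNReal.ofReal 2) volume := by
    simpa using (𝓕⁻ φ : 𝓢(Rn n, ℂ)).memLp 2 volume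
  have hm' : MemLp (𝓕 f : L2 n) (ENNReal.ofReal 2) volume := by
    simpa using Lp.memLp (𝓕 f : L2 n)
  have h := integral_mul_norm_le_Lp_mul_Lq (μ := (volume : Measure (Rn n))) (p := 2) (q := 2)
    (Real.HolderConjugate.two_two) hm hm'
  have h1 : (∫ a, ‖(𝓕⁻ φ) a‖ ^ (2:ℝ)) ^ (1 / (2:ℝ)) = ‖(𝓕⁻ φ).toLp 2 volume‖ := by
    rw [SchwartzMap.norm_toLp, ((𝓕⁻ φ : 𝓢(Rn n, ℂ)).memLp 2 volume).eLpNorm_eq_integral_rpow_norm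
      (by norm_num) (by norm_num), ENNReal.toReal_ofReal (by positivity)]
    norm_num
  have h2 : (∫ a, ‖(𝓕 f : L2 n) a‖ ^ (2:ℝ)) ^ (1 / (2:ℝ)) = ‖f‖ := by
    rw [← Lp.norm_fourier_eq, Lp.norm_def, (Lp.memLp (𝓕 f : L2 n)).eLpNorm_eq_integral_rpow_norm
      (by norm_num) (by norm_num), ENNReal.toReal_ofReal (by positivity)]
    norm_num
  rw [h1, h2, mul_comm] at h
  refine (norm_integral_le_integral_norm _).trans (le_trans (le_of_eq ?_) h)
  simp only [norm_mul]

/-- When `𝓕⁻ φ` lives in the ball of radius `R`, so does `𝓕⁻ (Δ φ)`, and its `L²` norm grows by at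
most `(2πR)²`. The hierarchy for `φ, Δ φ, Δ² φ, …` then forces the difference to vanish on all such
`φ`, which determine its Fourier transform. -/
theorem IsSolution.unique {γ : ℝ} (hγ : 0 ≤ γ) {u₀ u₁ : L2 n} {u u' : ℝ → L2 n}
    (h : IsSolution γ u₀ u₁ u) (h' : IsSolution γ u₀ u₁ u') {t : ℝ} (ht : 0 ≤ t) :
    u' t = u t := by
  obtain ⟨hc, h0, v, w, hv0, hs⟩ := h
  obtain ⟨hc', h0', v', w', hv0', hs'⟩ := h'
  have hΔ : ∀ (T : 𝓢'(Rn n, ℂ)) φ, (Δ T) φ = T (Δ φ) :=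
    TemperedDistribution.laplacian_apply_apply
  simp only [hΔ] at hs hs'
  let F : 𝓢(Rn n, ℂ) → ℝ → ℂ := fun φ τ => toDist (u' τ) φ - toDist (u τ) φ
  let G : 𝓢(Rn n, ℂ) → ℝ → ℂ := fun φ τ => v' τ φ - v τ φ
  have hF : ∀ φ τ, 0 ≤ τ → HasDerivWithinAt (F φ) (G φ τ) (Ici 0) τ := fun φ τ hτ =>
    ((hs' φ).1 τ hτ).sub ((hs φ).1 τ hτ)
  have hFeq : ∀ φ τ, F φ τ = toDist (u' τ - u τ) φ := fun φ τ => by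
    have h1 := map_sub (Lp.toTemperedDistributionCLM ℂ (volume : Measure (Rn n)) 2) (u' τ) (u τ)
    have h2 := congrArg (fun T => T φ) h1
    simp only [Lp.toTemperedDistributionCLM_apply, sub_apply] at h2
    exact h2.symm
  obtain ⟨M, hM⟩ := isCompact_Icc.exists_bound_of_continuousOn
    ((hc'.sub hc).mono (Icc_subset_Ici_self : Icc 0 t ⊆ Ici 0))
  have hM0 : 0 ≤ M := (norm_nonneg _).trans (hM 0 ⟨le_rfl, ht⟩)
  have hzero : ∀ R : ℝ, 0 ≤ R → ∀ φ : 𝓢(Rn n, ℂ), (∀ ξ, R < ‖ξ‖ → (𝓕⁻ φ) ξ = 0) → F φ t = 0 := by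
    intro R hR φ hφ
    refine eq_zero_of_bounded_hierarchy (S := {φ : 𝓢(Rn n, ℂ) | ∀ ξ : Rn n, R < ‖ξ‖ → (𝓕⁻ φ : 𝓢(Rn n, ℂ)) ξ = 0})
      (A := fun φ : 𝓢(Rn n, ℂ) => Δ φ) (N := fun φ : 𝓢(Rn n, ℂ) => ‖(𝓕⁻ φ).toLp 2 volume‖) (K := (2 * Real.pi * R) ^ 2)
      (M := M) (γ := γ) (T := t) hγ (sq_nonneg _) hM0 ht ?_ ?_ (fun _ => norm_nonneg _) hF
      (fun φ => (hs' φ).2.1.sub (hs φ).2.1) ?_ ?_ ?_ ?_ φ hφ t ⟨ht, le_rfl⟩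
    · intro φ hφ ξ hξ
      rw [fourierInv_laplacian_apply, hφ ξ hξ, mul_zero]
    · intro φ hφ
      refine Lp.norm_le_mul_norm_of_ae_le_mul ?_
      filter_upwards [(𝓕⁻ φ).coeFn_toLp 2 volume, (𝓕⁻ (Δ φ)).coeFn_toLp 2 volume] with ξ h1 h2
      rw [h1, h2, fourierInv_laplacian_apply, norm_mul, norm_neg, Complex.norm_real,
        Real.norm_of_nonneg (laplaceSymbol_nonneg ξ)]
      rcases lt_or_ge R ‖ξ‖ with hξ | hξ
      · simp [hφ ξ hξ]
      · rw [laplaceSymbol]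
        gcongr
    · intro φ τ hτ
      refine (((hs' φ).2.2.1 τ hτ).sub ((hs φ).2.2.1 τ hτ)).congr_deriv ?_
      have e := (hs φ).2.2.2 τ hτ
      have e' := (hs' φ).2.2.2 τ hτ
      have hi : ∀ q : ℝ → L2 n, (∀ σ, 0 ≤ σ → ContinuousWithinAt (fun σ => toDist (q σ) (Δ φ))
          (Ici 0) σ) → IntervalIntegrable
          (fun η => (relaxation γ (τ - η) : ℂ) * toDist (q η) (Δ φ)) volume 0 τ := fun q hq => by
        refine ContinuousOn.intervalIntegrable ?_
        rw [uIcc_of_le hτ.le]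
        refine ContinuousOn.mul (Continuous.continuousOn ?_)
          (fun σ hσ => (hq σ hσ.1).mono Icc_subset_Ici_self)
        unfold relaxation
        fun_prop
      have hsub : ∫ η in (0:ℝ)..τ, (relaxation γ (τ - η) : ℂ) * F (Δ φ) η
          = (∫ η in (0:ℝ)..τ, (relaxation γ (τ - η) : ℂ) * toDist (u' η) (Δ φ))
            - ∫ η in (0:ℝ)..τ, (relaxation γ (τ - η) : ℂ) * toDist (u η) (Δ φ) := by
        rw [← intervalIntegral.integral_sub
          (hi u' fun σ hσ => ((hs' (Δ φ)).1 σ hσ).continuousWithinAt)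
          (hi u fun σ hσ => ((hs (Δ φ)).1 σ hσ).continuousWithinAt)]
        simp only [F, mul_sub]
      rw [hsub]
      simp only [F, G]
      linear_combination e' - e
    · intro φ
      simp [F, h0, h0']
    · intro φ
      simp [G, hv0, hv0']
    · intro φ _ τ hτ
      rw [hFeq]
      exact (norm_toDist_apply_le _ _).trans
        (mul_le_mul_of_nonneg_right (hM τ hτ) (norm_nonneg _))
  have hfour : (𝓕 (u' t - u t) : L2 n) =ᵐ[volume] (fun _ => 0 : Rn n → ℂ) := by
    refine ae_eq_of_forall_integral_schwartz_mul
      ((Lp.memLp _).locallyIntegrable (by norm_num)) (locallyIntegrable_const 0) fun χ hχ => ?_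
    obtain ⟨R, hR⟩ := hχ.isCompact.isBounded.subset_closedBall (0 : Rn n)
    -- Testing with `𝓕 χ` puts `χ` itself on the frequency side; the maximum guards against a
    -- negative radius.
    have h1 := hzero (max R 0) (le_max_right _ _) (𝓕 χ) fun ξ hξ => by
      rw [fourierInv_fourier_eq]
      by_contra hne
      have := hR (subset_tsupport _ (Function.mem_support.2 hne))
      rw [mem_closedBall_zero_iff] at this
      exact absurd ((le_max_left R 0).trans_lt hξ) (not_lt.2 this)
    rw [hFeq, toDist_apply_eq_integral_fourierInv, fourierInv_fourier_eq] at h1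
    simpa using h1
  have hz : (𝓕 (u' t - u t) : L2 n) = 0 := Lp.eq_zero_iff_ae_eq_zero.2 hfour
  rw [← sub_eq_zero, ← norm_eq_zero, ← Lp.norm_fourier_eq, hz, norm_zero]

/-! ### Decay -/

/-- The constant comes from `log x ≤ x - 1` at `x = (c / β)(1 + t)`. It converts the exponential
decay of the high frequencies into the polynomial rates of the low ones. -/
theorem exists_exp_neg_mul_le_rpow {c β : ℝ} (hc : 0 < c) (hβ : 0 < β) :
    ∃ K : ℝ, 0 ≤ K ∧ ∀ t : ℝ, 0 ≤ t → Real.exp (-c * t) ≤ K * (1 + t) ^ (-β) := by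
  refine ⟨Real.exp (c - β - β * Real.log (c / β)), (Real.exp_pos _).le, fun t ht => ?_⟩
  have hx : 0 < 1 + t := by linarith
  have hε : 0 < c / β := div_pos hc hβ
  rw [Real.rpow_def_of_pos hx, ← Real.exp_add]
  apply Real.exp_le_exp.2
  have h := Real.log_le_sub_one_of_pos (mul_pos hε hx)
  rw [Real.log_mul hε.ne' hx.ne'] at h
  have h2 := mul_le_mul_of_nonneg_left h hβ.le
  have h3 : β * (c / β * (1 + t) - 1) = c * (1 + t) - β := by field_simp
  rw [h3] at h2
  linarith

theorem norm_le_one_of_laplaceSymbol_le {ξ : Rn n} (h : laplaceSymbol ξ ≤ 2) : ‖ξ‖ ≤ 1 := by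
  by_contra! hlt
  have hπ := Real.pi_gt_three
  rw [laplaceSymbol] at h
  nlinarith [mul_lt_mul'' hπ hlt (by norm_num) (by norm_num)]

theorem rpow_norm_le_one_add_laplaceSymbol {s : ℝ} (hs : 0 ≤ s) (ξ : Rn n) :
    (2 * Real.pi * ‖ξ‖) ^ s ≤ (1 + laplaceSymbol ξ) ^ (s / 2) := by
  have hρ : 0 ≤ 2 * Real.pi * ‖ξ‖ := by positivity
  calc (2 * Real.pi * ‖ξ‖) ^ s = laplaceSymbol ξ ^ (s / 2) := by
        rw [laplaceSymbol, ← Real.rpow_natCast, ← Real.rpow_mul hρ]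
        congr 1
        push_cast; ring
    _ ≤ _ := Real.rpow_le_rpow (laplaceSymbol_nonneg ξ) (by linarith) (by linarith)

/-- The factor `1/|ξ|²` of the high-frequency `(0, 1)` mode lowers the order from `s` to `s - 2`; if
`s < 2` the negative power is simply bounded, hence the maximum. -/
theorem rpow_norm_div_laplaceSymbol_le (s : ℝ) {ξ : Rn n} (h : 2 ≤ laplaceSymbol ξ) :
    (2 * Real.pi * ‖ξ‖) ^ s / laplaceSymbol ξ
      ≤ (1 + laplaceSymbol ξ) ^ (max (s - 2) 0 / 2) := by
  have hρ : 0 ≤ 2 * Real.pi * ‖ξ‖ := by positivity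
  have hσ : 0 < laplaceSymbol ξ := by linarith
  calc (2 * Real.pi * ‖ξ‖) ^ s / laplaceSymbol ξ = laplaceSymbol ξ ^ (s / 2 - 1) := by
        rw [Real.rpow_sub hσ, Real.rpow_one]
        congr 1
        rw [laplaceSymbol, ← Real.rpow_natCast, ← Real.rpow_mul hρ]
        congr 1
        push_cast; ring
    _ ≤ laplaceSymbol ξ ^ (max (s - 2) 0 / 2) :=
        Real.rpow_le_rpow_of_exponent_le (by linarith) (by linarith [le_max_left (s - 2) 0])
    _ ≤ _ := Real.rpow_le_rpow hσ.le (by linarith) (by positivity)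

/-- The heat kernel type majorant of the low frequency part. -/
noncomputable def lowMajorant (n : ℕ) (c σ t : ℝ) (ξ : Rn n) : ℝ :=
  if ‖ξ‖ ≤ 1 then ‖ξ‖ ^ σ * Real.exp (-(c * (2 * Real.pi) ^ 2) * ‖ξ‖ ^ 2 * t) else 0

theorem lowMajorant_nonneg (c σ t : ℝ) (ξ : Rn n) : 0 ≤ lowMajorant n c σ t ξ := by
  unfold lowMajorant
  split_ifs
  · positivity
  · exact le_rfl

theorem rpow_mul_exp_eq_lowMajorant {c σ t : ℝ} {ξ : Rn n} (h : laplaceSymbol ξ ≤ 2) :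
    (2 * Real.pi * ‖ξ‖) ^ σ * Real.exp (-c * laplaceSymbol ξ * t)
      = (2 * Real.pi) ^ σ * lowMajorant n c σ t ξ := by
  rw [lowMajorant, if_pos (norm_le_one_of_laplaceSymbol_le h),
    Real.mul_rpow (by positivity) (norm_nonneg _), mul_assoc, laplaceSymbol]
  congr 3
  ring

theorem growthG_nonneg {t : ℝ} (ht : 0 ≤ t) (s : ℝ) (n : ℕ) : 0 ≤ growthG t s n := by
  have h1 : 0 ≤ Real.log (Real.exp 1 + t) :=
    Real.log_nonneg (by linarith [Real.add_one_le_exp (1 : ℝ)])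
  unfold growthG
  split_ifs <;> positivity

/-- With `m = 2s + n`, the exponents are `1/2 - m/4` and `1 - 5m/12`; the first is the smaller one
exactly for `m ≤ 3`. -/
theorem rpow_le_growthG {t s : ℝ} (ht : 0 ≤ t) {n : ℕ} (hm : 2 < 2 * s + n) :
    (1 + t) ^ (1 / 2 - s / 2 - (n : ℝ) / 4) ≤ growthG t s n := by
  unfold growthG
  rw [if_neg (by linarith), if_neg (by linarith)]
  split_ifs with h
  · exact Real.rpow_le_rpow_of_exponent_le (by linarith) (by linarith)
  · exact le_rfl

/-- The `L²` size of `|ξ|^s` times the mode with data `(0, 1)` at low frequencies. -/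
theorem exists_l2Bound_low_mode (hn : 1 ≤ n) {γ : ℝ} (hγ : 1 < γ) {s : ℝ} (hs : 0 ≤ s) :
    ∃ C : ℝ, 0 ≤ C ∧ ∀ t : ℝ, 0 ≤ t → ∃ q : Rn n → ℝ, (∀ ξ, 0 ≤ q ξ) ∧
      (∀ ξ : Rn n, ξ ≠ 0 → laplaceSymbol ξ ≤ 2 →
        ‖ξ‖ ^ s * |(modeFlow γ (0, 1, 0) t (laplaceSymbol ξ)).1| ≤ q ξ) ∧
      L2Bound q (C * growthG t s n) := by
  obtain ⟨C, c, hC, hc, hdec⟩ := exists_modeFlow_decay hγ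
  have hπ := Real.pi_gt_three
  have hlow : ∀ (t : ℝ) (ξ : Rn n), 0 ≤ t → ξ ≠ 0 → laplaceSymbol ξ ≤ 2 →
      |(modeFlow γ (0, 1, 0) t (laplaceSymbol ξ)).1|
        ≤ C * Real.exp (-c * laplaceSymbol ξ * t) / (2 * Real.pi * ‖ξ‖) ∧
      |(modeFlow γ (0, 1, 0) t (laplaceSymbol ξ)).1| ≤ C * t := fun t ξ ht hξ h2 => by
    have hpos : 0 < ‖ξ‖ := norm_pos_iff.2 hξ
    have hσ : 0 < laplaceSymbol ξ := by unfold laplaceSymbol; positivity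
    have h := ((hdec t _ ht hσ).1 h2).2
    have hsq : √(laplaceSymbol ξ) = 2 * Real.pi * ‖ξ‖ := Real.sqrt_sq (by positivity)
    rwa [hsq] at h
  have hmin : ∀ (t : ℝ) (ξ : Rn n), 0 ≤ t → ξ ≠ 0 → laplaceSymbol ξ ≤ 2 →
      ‖ξ‖ ^ s * |(modeFlow γ (0, 1, 0) t (laplaceSymbol ξ)).1|
        ≤ C * (‖ξ‖ ^ s * min (1 + t) (1 / ‖ξ‖)) := fun t ξ ht hξ h2 => by
    have hpos : 0 < ‖ξ‖ := norm_pos_iff.2 hξ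
    rw [mul_left_comm]
    refine mul_le_mul_of_nonneg_left ?_ (Real.rpow_nonneg hpos.le _)
    obtain ⟨h1, h3⟩ := hlow t ξ ht hξ h2
    rw [mul_min_of_nonneg _ _ hC.le]
    refine le_min (h3.trans (mul_le_mul_of_nonneg_left (by linarith) hC.le)) (h1.trans ?_)
    rw [mul_div_assoc]
    refine mul_le_mul_of_nonneg_left ?_ hC.le
    refine div_le_div₀ zero_le_one (Real.exp_le_one_iff.2 ?_) hpos (by nlinarith)
    have : 0 ≤ c * laplaceSymbol ξ * t := by
      have := laplaceSymbol_nonneg ξ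
      positivity
    linarith
  have hmin0 : ∀ (t : ℝ) (ξ : Rn n), 0 ≤ t → 0 ≤ ‖ξ‖ ^ s * min (1 + t) (1 / ‖ξ‖) :=
    fun t ξ ht => mul_nonneg (by positivity) (le_min (by positivity) (by positivity))
  -- Up to the threshold the majorant `min(1+t, 1/|ξ|)` is used. Beyond it `|ξ|^{s-1}` is square
  -- integrable near `0`, so the heat majorant of order `s - 1` applies directly.
  rcases lt_trichotomy (2 * s + n) 2 with hm | hm | hm
  · obtain ⟨D, hD, hb⟩ := exists_l2Bound_rpow_mul_min hn hs hm
    refine ⟨C * D, by positivity, fun t ht => ⟨fun ξ => C * (‖ξ‖ ^ s * min (1 + t) (1 / ‖ξ‖)),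
      fun ξ => mul_nonneg hC.le (hmin0 t ξ ht), fun ξ => hmin t ξ ht, ?_⟩⟩
    refine ((hb (1 + t) (by linarith)).const_mul hC.le).mono (le_of_eq ?_)
    rw [growthG, if_pos hm]
    ring
  · obtain ⟨D, hD, hb⟩ := exists_l2Bound_rpow_mul_min_log hn hm le_rfl
    refine ⟨C * D, by positivity, fun t ht => ⟨fun ξ => C * (if ‖ξ‖ ≤ 1 then
      ‖ξ‖ ^ s * min (1 + t) (1 / ‖ξ‖) else 0), fun ξ => mul_nonneg hC.le ?_,
      fun ξ hξ h2 => ?_, ?_⟩⟩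
    · split_ifs
      · exact hmin0 t ξ ht
      · exact le_rfl
    · beta_reduce
      rw [if_pos (norm_le_one_of_laplaceSymbol_le h2)]
      exact hmin t ξ ht hξ h2
    · refine ((hb t ht).const_mul hC.le).mono (le_of_eq ?_)
      rw [growthG, if_neg (by linarith), if_pos hm]
      ring
  · obtain ⟨D, hD, hb⟩ := exists_l2Bound_rpow_mul_exp hn (σ := s - 1)
      (c := c * (2 * Real.pi) ^ 2) (by linarith) (by positivity) 1
    refine ⟨C * D, by positivity, fun t ht => ⟨fun ξ => C * lowMajorant n c (s - 1) t ξ,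
      fun ξ => mul_nonneg hC.le (lowMajorant_nonneg _ _ _ _), fun ξ hξ h2 => ?_, ?_⟩⟩
    · have hpos : 0 < ‖ξ‖ := norm_pos_iff.2 hξ
      have h1 := (hlow t ξ ht hξ h2).1
      have hexp : Real.exp (-c * laplaceSymbol ξ * t)
          = Real.exp (-(c * (2 * Real.pi) ^ 2) * ‖ξ‖ ^ 2 * t) := by
        rw [laplaceSymbol]; congr 1; ring
      beta_reduce
      rw [lowMajorant, if_pos (norm_le_one_of_laplaceSymbol_le h2), ← hexp,
        Real.rpow_sub hpos, Real.rpow_one]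
      have h3 : C * Real.exp (-c * laplaceSymbol ξ * t) / (2 * Real.pi * ‖ξ‖)
          ≤ C * Real.exp (-c * laplaceSymbol ξ * t) / ‖ξ‖ :=
        div_le_div_of_nonneg_left (by positivity) hpos (by nlinarith)
      refine (mul_le_mul_of_nonneg_left (h1.trans h3) (Real.rpow_nonneg hpos.le s)).trans
        (le_of_eq (by ring))
    · refine ((hb t ht).const_mul hC.le).mono ?_
      rw [← mul_assoc]
      refine mul_le_mul_of_nonneg_left ((le_of_eq ?_).trans (rpow_le_growthG ht hm))
        (by positivity)
      congr 1; ring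

/-- The pointwise bound for `|ξ|^s û(t, ξ)`. -/
theorem rpow_mul_norm_modeSpectrum_le {γ C c : ℝ} (hC : 0 < C)
    (hdec : ∀ t a : ℝ, 0 ≤ t → 0 < a →
      (a ≤ 2 → |(modeFlow γ (1, 0, 0) t a).1| ≤ C * Real.exp (-c * a * t) ∧
        |(modeFlow γ (0, 1, 0) t a).1| ≤ C * Real.exp (-c * a * t) / √a ∧
        |(modeFlow γ (0, 1, 0) t a).1| ≤ C * t) ∧
      (2 ≤ a → |(modeFlow γ (1, 0, 0) t a).1| ≤ C * Real.exp (-c * t) ∧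
        |(modeFlow γ (0, 1, 0) t a).1| ≤ C * Real.exp (-c * t) / a))
    {s : ℝ} (hs : 0 ≤ s) {f g : Rn n → ℂ} {t : ℝ} (ht : 0 ≤ t) {ξ : Rn n} (hξ : ξ ≠ 0)
    {p₀ p₁ N₀ N₁ q : ℝ} (hp₀ : 0 ≤ p₀) (hp₁ : 0 ≤ p₁) (hN₀ : 0 ≤ N₀) (hN₁ : 0 ≤ N₁) (hq0 : 0 ≤ q)
    (hf : ‖f ξ‖ ≤ p₀ + 2 * Real.pi * ‖ξ‖ * N₀) (hg : ‖g ξ‖ ≤ p₁ + 2 * Real.pi * ‖ξ‖ * N₁)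
    (hq : laplaceSymbol ξ ≤ 2 →
      ‖ξ‖ ^ s * |(modeFlow γ (0, 1, 0) t (laplaceSymbol ξ)).1| ≤ q) :
    (2 * Real.pi * ‖ξ‖) ^ s * ‖modeSpectrum γ u f g t ξ‖ ≤
      C * Real.exp (-c * t) * ((1 + laplaceSymbol ξ) ^ (s / 2) * ‖f ξ‖)
      + C * Real.exp (-c * t) * ((1 + laplaceSymbol ξ) ^ (max (s - 2) 0 / 2) * ‖g ξ‖)
      + C * (2 * Real.pi) ^ (s + 1) * N₀ * lowMajorant n c (s + 1) t ξ
      + C * (2 * Real.pi) ^ s * p₀ * lowMajorant n c s t ξ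
      + C * (2 * Real.pi) ^ s * N₁ * lowMajorant n c s t ξ
      + (2 * Real.pi) ^ s * p₁ * q := by
  have hpos : 0 < ‖ξ‖ := norm_pos_iff.2 hξ
  have hσ : 0 < laplaceSymbol ξ := by unfold laplaceSymbol; positivity
  have hnorm : ‖modeSpectrum γ u f g t ξ‖ ≤
      |(modeFlow γ (1, 0, 0) t (laplaceSymbol ξ)).1| * ‖f ξ‖
        + |(modeFlow γ (0, 1, 0) t (laplaceSymbol ξ)).1| * ‖g ξ‖ := by
    refine (norm_add_le _ _).trans (le_of_eq ?_)
    rw [norm_mul, norm_mul, Complex.norm_real, Complex.norm_real]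
    rfl
  set U₀ := |(modeFlow γ (1, 0, 0) t (laplaceSymbol ξ)).1|
  set U₁ := |(modeFlow γ (0, 1, 0) t (laplaceSymbol ξ)).1|
  have hU₁ : 0 ≤ U₁ := abs_nonneg _
  set ρ := 2 * Real.pi * ‖ξ‖ with hρ
  have hρ0 : 0 < ρ := by positivity
  have hρs : 0 ≤ ρ ^ s := Real.rpow_nonneg hρ0.le s
  have hm1 := lowMajorant_nonneg c (s + 1) t ξ
  have hm2 := lowMajorant_nonneg c s t ξ
  have hA : 0 ≤ C * Real.exp (-c * t) * ((1 + laplaceSymbol ξ) ^ (s / 2) * ‖f ξ‖) := by positivity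
  have hB : 0 ≤ C * Real.exp (-c * t) * ((1 + laplaceSymbol ξ) ^ (max (s - 2) 0 / 2) * ‖g ξ‖) := by
    positivity
  have hD1 : 0 ≤ C * (2 * Real.pi) ^ (s + 1) * N₀ * lowMajorant n c (s + 1) t ξ := by positivity
  have hD2 : 0 ≤ C * (2 * Real.pi) ^ s * p₀ * lowMajorant n c s t ξ := by positivity
  have hD3 : 0 ≤ C * (2 * Real.pi) ^ s * N₁ * lowMajorant n c s t ξ := by positivity
  have hD4 : 0 ≤ (2 * Real.pi) ^ s * p₁ * q := by positivity
  rcases le_total (laplaceSymbol ξ) 2 with h2 | h2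
  · obtain ⟨h0, h1, -⟩ := (hdec t _ ht hσ).1 h2
    have hsq : √(laplaceSymbol ξ) = ρ := Real.sqrt_sq hρ0.le
    rw [hsq, le_div_iff₀ hρ0] at h1
    set e := Real.exp (-c * laplaceSymbol ξ * t)
    have e1 : ρ ^ (s + 1) * e = (2 * Real.pi) ^ (s + 1) * lowMajorant n c (s + 1) t ξ :=
      rpow_mul_exp_eq_lowMajorant h2
    have e2 : ρ ^ s * e = (2 * Real.pi) ^ s * lowMajorant n c s t ξ :=
      rpow_mul_exp_eq_lowMajorant h2
    have hsplit : ρ ^ (s + 1) = ρ ^ s * ρ := by rw [Real.rpow_add hρ0, Real.rpow_one]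
    have i1 : ρ ^ s * (U₀ * ‖f ξ‖) ≤ C * (2 * Real.pi) ^ (s + 1) * N₀ * lowMajorant n c (s + 1) t ξ
        + C * (2 * Real.pi) ^ s * p₀ * lowMajorant n c s t ξ := by
      calc ρ ^ s * (U₀ * ‖f ξ‖) ≤ ρ ^ s * ((C * e) * (p₀ + ρ * N₀)) := by gcongr
        _ = C * N₀ * (ρ ^ (s + 1) * e) + C * p₀ * (ρ ^ s * e) := by rw [hsplit]; ring
        _ = _ := by rw [e1, e2]; ring
    have i2 : ρ ^ s * (U₁ * ‖g ξ‖) ≤ C * (2 * Real.pi) ^ s * N₁ * lowMajorant n c s t ξ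
        + (2 * Real.pi) ^ s * p₁ * q := by
      have hρs' : ρ ^ s = (2 * Real.pi) ^ s * ‖ξ‖ ^ s :=
        Real.mul_rpow (by positivity) (norm_nonneg _)
      -- In the moment part the factor `ρ` cancels the singularity `1/ρ` of `U₁`, leaving a heat
      -- majorant of order `s`; only `p₁` multiplies `U₁` itself, bounded by `q`.
      calc ρ ^ s * (U₁ * ‖g ξ‖) ≤ ρ ^ s * (U₁ * (p₁ + ρ * N₁)) := by gcongr
        _ = ρ ^ s * (U₁ * ρ) * N₁ + p₁ * (ρ ^ s * U₁) := by ring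
        _ ≤ ρ ^ s * (C * e) * N₁ + p₁ * ((2 * Real.pi) ^ s * q) := by
            refine add_le_add (by gcongr) (mul_le_mul_of_nonneg_left ?_ hp₁)
            rw [hρs', mul_assoc]
            exact mul_le_mul_of_nonneg_left (hq h2) (by positivity)
        _ = C * N₁ * (ρ ^ s * e) + (2 * Real.pi) ^ s * p₁ * q := by ring
        _ = _ := by rw [e2]; ring
    have := mul_le_mul_of_nonneg_left hnorm hρs
    rw [mul_add] at this
    linarith
  · obtain ⟨h0, h1⟩ := (hdec t _ ht hσ).2 h2
    have i1 : ρ ^ s * (U₀ * ‖f ξ‖) ≤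
        C * Real.exp (-c * t) * ((1 + laplaceSymbol ξ) ^ (s / 2) * ‖f ξ‖) := by
      have := rpow_norm_le_one_add_laplaceSymbol hs ξ
      calc ρ ^ s * (U₀ * ‖f ξ‖)
          ≤ (1 + laplaceSymbol ξ) ^ (s / 2) * (C * Real.exp (-c * t) * ‖f ξ‖) := by gcongr
        _ = _ := by ring
    have i2 : ρ ^ s * (U₁ * ‖g ξ‖) ≤
        C * Real.exp (-c * t) * ((1 + laplaceSymbol ξ) ^ (max (s - 2) 0 / 2) * ‖g ξ‖) := by
      have := rpow_norm_div_laplaceSymbol_le s h2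
      calc ρ ^ s * (U₁ * ‖g ξ‖)
          ≤ ρ ^ s * (C * Real.exp (-c * t) / laplaceSymbol ξ * ‖g ξ‖) := by gcongr
        _ = ρ ^ s / laplaceSymbol ξ * (C * Real.exp (-c * t) * ‖g ξ‖) := by ring
        _ ≤ (1 + laplaceSymbol ξ) ^ (max (s - 2) 0 / 2) * (C * Real.exp (-c * t) * ‖g ξ‖) := by
            gcongr
        _ = _ := by ring
    have := mul_le_mul_of_nonneg_left hnorm hρs
    rw [mul_add] at this
    linarith

theorem exists_l2Bound_rpow_mul_modeSpectrum (hn : 1 ≤ n) {γ : ℝ} (hγ : 1 < γ) {s : ℝ}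
    (hs : 0 ≤ s) : ∃ C : ℝ, 0 < C ∧ ∀ u₀ u₁ : L2 n,
      MemH s u₀ → MemL11 u₀ → MemH (max (s - 2) 0) u₁ → MemL11 u₁ → ∀ t : ℝ, 0 ≤ t →
      L2Bound (fun ξ : Rn n => (((2 * Real.pi * ‖ξ‖) ^ s : ℝ) : ℂ) *
          modeSpectrum γ u ((𝓕 u₀ : L2 n) : Rn n → ℂ) ((𝓕 u₁ : L2 n) : Rn n → ℂ) t ξ)
        (C * ((1 + t) ^ (-(s + 1) / 2 - (n : ℝ) / 4) * (normH s u₀ + normL11 u₀)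
            + (1 + t) ^ (-s / 2 - (n : ℝ) / 4) * ‖totalIntegral u₀‖
            + (1 + t) ^ (-s / 2 - (n : ℝ) / 4) * (normH (max (s - 2) 0) u₁ + normL11 u₁)
            + growthG t s n * ‖totalIntegral u₁‖)) := by
  obtain ⟨C, c, hC, hc, hdec⟩ := exists_modeFlow_decay hγ
  have hn' : (1 : ℝ) ≤ n := by exact_mod_cast hn
  have hc' : 0 < c * (2 * Real.pi) ^ 2 := by positivity
  obtain ⟨K₁, hK₁, hexp₁⟩ := exists_exp_neg_mul_le_rpow hc
    (by positivity : 0 < (s + 1) / 2 + (n : ℝ) / 4)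
  obtain ⟨K₂, hK₂, hexp₂⟩ := exists_exp_neg_mul_le_rpow hc
    (by positivity : 0 < s / 2 + (n : ℝ) / 4)
  obtain ⟨D₁, hD₁, hlow₁⟩ := exists_l2Bound_rpow_mul_exp hn (σ := s + 1) (by linarith) hc' 1
  obtain ⟨D₂, hD₂, hlow₂⟩ := exists_l2Bound_rpow_mul_exp hn (σ := s) (by linarith) hc' 1
  obtain ⟨D₃, hD₃, hlow₃⟩ := exists_l2Bound_low_mode hn hγ hs
  set k₁ := C * K₁ with hk₁
  set k₂ := C * K₂ with hk₂
  set k₃ := C * (2 * Real.pi) ^ (s + 1) * D₁ with hk₃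
  set k₄ := C * (2 * Real.pi) ^ s * D₂ with hk₄
  set k₅ := (2 * Real.pi) ^ s * D₃ with hk₅
  have a₁ : 0 ≤ k₁ := by positivity
  have a₂ : 0 ≤ k₂ := by positivity
  have a₃ : 0 ≤ k₃ := by positivity
  have a₄ : 0 ≤ k₄ := by positivity
  have a₅ : 0 ≤ k₅ := by positivity
  -- Each of the six terms of the pointwise bound has its coefficient among the `kᵢ`, with `k₄` used
  -- twice; the final `1` makes the constant strictly positive.
  refine ⟨k₁ + k₂ + k₃ + k₄ + k₅ + 1, by positivity, fun u₀ u₁ hH₀ hL₀ hH₁ hL₁ t ht => ?_⟩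
  have hT : 0 < 1 + t := by linarith
  obtain ⟨q, hq0, hq, hqb⟩ := hlow₃ t ht
  have hx₁ := hexp₁ t ht
  have hx₂ := hexp₂ t ht
  rw [show -((s + 1) / 2 + (n : ℝ) / 4) = -(s + 1) / 2 - (n : ℝ) / 4 by ring] at hx₁
  rw [show -(s / 2 + (n : ℝ) / 4) = -s / 2 - (n : ℝ) / 4 by ring] at hx₂
  set E₁ := (1 + t) ^ (-(s + 1) / 2 - (n : ℝ) / 4)
  set E₂ := (1 + t) ^ (-s / 2 - (n : ℝ) / 4)
  have hE₁ : 0 ≤ E₁ := by positivity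
  have hE₂ : 0 ≤ E₂ := by positivity
  have hG := growthG_nonneg ht s n
  have hH₀n := normH_nonneg s u₀
  have hH₁n := normH_nonneg (max (s - 2) 0) u₁
  have hN₀ := normL11_nonneg u₀
  have hN₁ := normL11_nonneg u₁
  have hP₀ := norm_nonneg (totalIntegral u₀)
  have hP₁ := norm_nonneg (totalIntegral u₁)
  have b₁ := (l2Bound_of_memH hs hH₀).const_mul
    (by positivity : 0 ≤ C * Real.exp (-c * t))
  have b₂ := (l2Bound_of_memH (le_max_right _ _) hH₁).const_mul
    (by positivity : 0 ≤ C * Real.exp (-c * t))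
  have b₃ := (hlow₁ t ht).const_mul
    (by positivity : 0 ≤ C * (2 * Real.pi) ^ (s + 1) * normL11 u₀)
  have b₄ := (hlow₂ t ht).const_mul
    (by positivity : 0 ≤ C * (2 * Real.pi) ^ s * ‖totalIntegral u₀‖)
  have b₅ := (hlow₂ t ht).const_mul
    (by positivity : 0 ≤ C * (2 * Real.pi) ^ s * normL11 u₁)
  have b₆ := hqb.const_mul (by positivity : 0 ≤ (2 * Real.pi) ^ s * ‖totalIntegral u₁‖)
  have hsum := (((((b₁.add b₂ (by positivity) (by positivity)).add b₃ (by positivity)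
    (by positivity)).add b₄ (by positivity) (by positivity)).add b₅ (by positivity)
    (by positivity)).add b₆ (by positivity) (by positivity))
  refine (hsum.of_ae_le ?_ ?_).mono ?_
  · refine AEStronglyMeasurable.mul (Continuous.aestronglyMeasurable
      (Complex.continuous_ofReal.comp (Continuous.rpow_const (by fun_prop) fun _ => Or.inr hs)))
      (aestronglyMeasurable_spectrum u t (Lp.aestronglyMeasurable _) (Lp.aestronglyMeasurable _))
  · have : Nonempty (Fin n) := ⟨⟨0, hn⟩⟩
    have : Nontrivial (Rn n) := inferInstance
    have hne : ∀ᵐ ξ : Rn n, ξ ≠ 0 := Measure.ae_ne volume 0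
    filter_upwards [ae_norm_fourier_le u₀ hL₀, ae_norm_fourier_le u₁ hL₁, hne] with ξ h₀ h₁ hξ
    rw [norm_mul, Complex.norm_real, Real.norm_of_nonneg (by positivity)]
    exact rpow_mul_norm_modeSpectrum_le hC hdec hs ht hξ hP₀ hP₁ hN₀ hN₁ (hq0 ξ) h₀ h₁ (hq ξ hξ)
  · have j₁ : C * Real.exp (-c * t) * normH s u₀ ≤ k₁ * (E₁ * normH s u₀) := by
      rw [hk₁]
      calc _ ≤ C * (K₁ * E₁) * normH s u₀ := by gcongr
        _ = _ := by ring
    have j₂ : C * Real.exp (-c * t) * normH (max (s - 2) 0) u₁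
        ≤ k₂ * (E₂ * normH (max (s - 2) 0) u₁) := by
      rw [hk₂]
      calc _ ≤ C * (K₂ * E₂) * normH (max (s - 2) 0) u₁ := by gcongr
        _ = _ := by ring
    have hle : ∀ k x : ℝ, 0 ≤ x → k ≤ k₁ + k₂ + k₃ + k₄ + k₅ + 1 →
        k * x ≤ (k₁ + k₂ + k₃ + k₄ + k₅ + 1) * x := fun k x hx hk =>
      mul_le_mul_of_nonneg_right hk hx
    have l₁ := hle k₁ (E₁ * normH s u₀) (by positivity) (by linarith)
    have l₂ := hle k₂ (E₂ * normH (max (s - 2) 0) u₁) (by positivity) (by linarith)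
    have l₃ := hle k₃ (E₁ * normL11 u₀) (by positivity) (by linarith)
    have l₄ := hle k₄ (E₂ * ‖totalIntegral u₀‖) (by positivity) (by linarith)
    have l₅ := hle k₄ (E₂ * normL11 u₁) (by positivity) (by linarith)
    have l₆ := hle k₅ (growthG t s n * ‖totalIntegral u₁‖) (by positivity) (by linarith)
    rw [hk₃] at l₃
    rw [hk₄] at l₄ l₅
    rw [hk₅] at l₆
    calc _ ≤ (k₁ + k₂ + k₃ + k₄ + k₅ + 1) * (E₁ * normH s u₀)
          + (k₁ + k₂ + k₃ + k₄ + k₅ + 1) * (E₂ * normH (max (s - 2) 0) u₁)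
          + (k₁ + k₂ + k₃ + k₄ + k₅ + 1) * (E₁ * normL11 u₀)
          + (k₁ + k₂ + k₃ + k₄ + k₅ + 1) * (E₂ * ‖totalIntegral u₀‖)
          + (k₁ + k₂ + k₃ + k₄ + k₅ + 1) * (E₂ * normL11 u₁)
          + (k₁ + k₂ + k₃ + k₄ + k₅ + 1) * (growthG t s n * ‖totalIntegral u₁‖) := by
          refine add_le_add (add_le_add (add_le_add (add_le_add (add_le_add (j₁.trans l₁)
            (j₂.trans l₂)) (le_trans (le_of_eq ?_) l₃)) (le_trans (le_of_eq ?_) l₄))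
            (le_trans (le_of_eq ?_) l₅)) (le_trans (le_of_eq ?_) l₆) <;> ring
      _ = _ := by ring

theorem mainTheorem2 (n : ℕ) (hn : 1 ≤ n) (γ : ℝ) (hγ : 1 < γ) (s : ℝ) (hs : 0 ≤ s) :
    ∃ C : ℝ, 0 < C ∧ ∀ u₀ u₁ : L2 n,
      MemH s u₀ → MemL11 u₀ → MemH (max (s - 2) 0) u₁ → MemL11 u₁ →
      ∃ u : ℝ → L2 n, IsSolution γ u₀ u₁ u ∧
        (∀ u' : ℝ → L2 n, IsSolution γ u₀ u₁ u' → ∀ t : ℝ, 0 ≤ t → u' t = u t) ∧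
        ∀ t : ℝ, 0 ≤ t → ∃ w : L2 n, IsFracDeriv s (u t) w ∧
          ‖w‖ ≤ C * ((1 + t) ^ (-(s + 1) / 2 - (n : ℝ) / 4) * (normH s u₀ + normL11 u₀)
            + (1 + t) ^ (-s / 2 - (n : ℝ) / 4) * ‖totalIntegral u₀‖
            + (1 + t) ^ (-s / 2 - (n : ℝ) / 4) * (normH (max (s - 2) 0) u₁ + normL11 u₁)
            + growthG t s n * ‖totalIntegral u₁‖) := by
  obtain ⟨C, hC, hbound⟩ := exists_l2Bound_rpow_mul_modeSpectrum hn hγ hs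
  refine ⟨C, hC, fun u₀ u₁ hH₀ hL₀ hH₁ hL₁ => ?_⟩
  have hsol := isSolution_ofSpectrum hγ u₀ u₁
  refine ⟨_, hsol, fun u' hu' t ht => hsol.unique (by linarith) hu' ht, fun t ht => ?_⟩
  have hb := hbound u₀ u₁ hH₀ hL₀ hH₁ hL₁ t ht
  refine ⟨ofSpectrum fun ξ => (((2 * Real.pi * ‖ξ‖) ^ s : ℝ) : ℂ) *
    modeSpectrum γ u ((𝓕 u₀ : L2 n) : Rn n → ℂ) ((𝓕 u₁ : L2 n) : Rn n → ℂ) t ξ, ?_, ?_⟩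
  · filter_upwards [fourier_ofSpectrum_ae hb.1,
      fourier_ofSpectrum_ae (memLp_modeSpectrum_u hγ (Lp.memLp (𝓕 u₀ : L2 n))
        (Lp.memLp (𝓕 u₁ : L2 n)) ht)] with ξ h1 h2
    rw [h1, h2]
  · rw [← Lp.norm_fourier_eq, fourier_ofSpectrum hb.1, Lp.norm_toLp]
    refine ENNReal.toReal_le_of_le_ofReal ?_ hb.2
    have h1 := normH_nonneg s u₀
    have h2 := normH_nonneg (max (s - 2) 0) u₁
    have h3 := normL11_nonneg u₀
    have h4 := normL11_nonneg u₁
    have h5 := growthG_nonneg ht s n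
    positivity
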